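/- \textbf{Setting.} Let $E$ be a finite set and, for $i\in E$, let $F^i:\mathbb{R}^d\to\mathbb{R}^d$ be a bounded smooth vector field with flow $\Phi^i_t$. Let $M\subset\mathbb{R}^d$ be compact with $\Phi^i_t(M)\subset M$ for all $i\in E$, $t\ge 0$. For $x\in M$ and $i,j\in E$ let $\lambda(x,i,j)$ be continuous in $x$, with $\lambda(x,i,j)\ge 0$ for $i\ne j$, $\lambda(x,i,i)=0$, and $(\lambda(x,i,j))_{i,j}$ irreducible for each $x\in M$. Fix a constant $\lambda>0$ with $\sum_{j\ne i}\lambda(x,i,j)<\lambda$ for all $(x,i)\in M\times E$, and put $$Q(x,i,j)=\frac{\lambda(x,i,j)}{\lambda}\ (i\neq j),\qquad Q(x,i,i)=1-\sum_{j\ne i}Q(x,i,j).$$ On functions on $M\times E$ let $$Qg(x,i)=\sum_{j\in E}Q(x,i,j)\,g(x,j),\qquad K_tg(x,i)=g(\Phi^i_t(x),i),\qquad \tilde K g=\int_0^\infty \lambda e^{-\lambda t}K_tg\,dt,$$ and write $\mu Q$, $\mu\tilde K$ for the measures defined by duality. Let $U_1,U_2,\dots$ be i.i.d. exponential random variables of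 parameter $\lambda$ and $T_n=U_1+\dots+U_n$. The embedded chain $\tilde Z_n=(\tilde X_n,\tilde Y_n)$ on $M\times E$ is obtained by setting $\tilde X_{n+1}=\Phi^{\tilde Y_n}_{U_{n+1}}(\tilde X_n)$ and then drawing $\tilde Y_{n+1}$ from $Q(\tilde X_{n+1},\tilde Y_n,\cdot)$; let $\tilde P$ be its transition operator. The continuous-time process is $Z_t=(\Phi^{\tilde Y_n}_{t-T_n}(\tilde X_n),\tilde Y_n)$ for $T_n\le t<T_{n+1}$; let $(P_t)_{t\ge0}$ be its semigroup, $P_tg(x,i)=\mathbb{E}[g(Z_t)\mid Z_0=(x,i)]$. Let $\tilde{\mathcal P}_{inv}$ be the set of probability measures $\mu$ on $M\times E$ with $\mu\tilde P=\mu$, and $\mathcal P_{inv}$ the set of those with $\mu P_t=\mu$ for all $t\ge0$, both with the topology of weak convergence. A process is called stable if it has exactly one invariant probability measure. \textbf{Proposition (Correspondence for invariant measures).} The map $\mu\mapsto\mu\tilde K$ is a homeomorphism from $\tilde{\mathcal P}_{inv}$ onto $\mathcal P_{inv}$, and its inverse is the restriction of $\mu\mapsto\mu Q$ to $\mathcal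 P_{inv}$. It maps the set of extremal points of $\tilde{\mathcal P}_{inv}$ onto the set of extremal points of $\mathcal P_{inv}$. These extremal points are exactly the ergodic probabilities for $\tilde P$ and for $(P_t)$ respectively, that is, the invariant probabilities $\mu$ such that $\mu(A)\in\{0,1\}$ for every measurable $A$ with $\tilde P\mathbf 1_A=\mathbf 1_A$ $\mu$-almost everywhere (respectively, with $P_t\mathbf 1_A=\mathbf 1_A$ $\mu$-almost everywhere for every $t\ge0$). Consequently $(Z_t)$ is stable if and only if $(\tilde Z_n)$ is stable. -/

import Mathlib

open MeasureTheory ProbabilityTheory Set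
open scoped NNReal ENNReal ContDiff

namespace SwitchedPDMP

/-! ### Flows of vector fields on Euclidean space -/

section Flow

variable {d : ℕ}

open Classical in
/-- `flow F t x` is the value at time `t` of the solution of `x' = F x` started at `x` at time `0`.
For bounded smooth `F` the solution exists for all times, see `flow_spec`. -/
noncomputable def flow (F : EuclideanSpace ℝ (Fin d) → EuclideanSpace ℝ (Fin d)) (t : ℝ)
    (x : EuclideanSpace ℝ (Fin d)) : EuclideanSpace ℝ (Fin d) :=
  if h : ∃ γ : ℝ → EuclideanSpace ℝ (Fin d), γ 0 = x ∧ ∀ s, HasDerivAt γ (F (γ s)) s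
  then h.choose t else x

variable {F : EuclideanSpace ℝ (Fin d) → EuclideanSpace ℝ (Fin d)}

theorem exists_lipschitzOnWith_closedBall (hF : ContDiff ℝ ∞ F) (x : EuclideanSpace ℝ (Fin d))
    (r : ℝ) : ∃ K : ℝ≥0, LipschitzOnWith K F (Metric.closedBall x r) := by
  have hcont : Continuous (fderiv ℝ F) := hF.continuous_fderiv (by simp)
  obtain ⟨C, hC⟩ := (isCompact_closedBall x r).exists_bound_of_continuousOn hcont.continuousOn
  refine ⟨C.toNNReal, (convex_closedBall x r).lipschitzOnWith_of_nnnorm_fderiv_le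
    (fun y _ => hF.differentiable (by simp) y) (fun y hy => ?_)⟩
  rw [← NNReal.coe_le_coe]
  exact (hC y hy).trans (Real.le_coe_toNNReal C)

theorem exists_solution (hF : ContDiff ℝ ∞ F) {C : ℝ} (hC : ∀ x, ‖F x‖ ≤ C)
    (x : EuclideanSpace ℝ (Fin d)) :
    ∃ γ : ℝ → EuclideanSpace ℝ (Fin d), γ 0 = x ∧ ∀ s, HasDerivAt γ (F (γ s)) s := by
  have hF1 : ContDiff ℝ 1 F := hF.of_le (by simp)
  have key := (exists_isMIntegralCurve_iff_exists_isMIntegralCurveOn_Ioo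
    (I := modelWithCornersSelf ℝ (EuclideanSpace ℝ (Fin d))) (v := F)
    (contMDiff_vectorSpace_iff_contDiff.2 hF1) x).2 ?_
  · obtain ⟨γ, h0, h⟩ := key
    exact ⟨γ, h0, fun s => hasMFDerivAt_iff_hasFDerivAt.1 (h s)⟩
  · intro a
    have hC0 : 0 ≤ C := (norm_nonneg _).trans (hC x)
    rcases le_or_gt a 0 with ha | ha
    · refine ⟨fun _ => x, rfl, fun t ht => ?_⟩
      exact absurd (ht.1.trans ht.2) (by linarith)
    have h0 : (0 : ℝ) ∈ Icc (-a) a := ⟨by linarith, ha.le⟩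
    obtain ⟨K, hK⟩ := exists_lipschitzOnWith_closedBall hF x ((C * a).toNNReal : ℝ≥0)
    have hPL : IsPicardLindelof (fun _ => F) (⟨0, h0⟩ : Icc (-a) a) x (C * a).toNNReal 0
        C.toNNReal K :=
      { lipschitzOnWith := fun _ _ => hK
        continuousOn := fun _ _ => continuousOn_const
        norm_le := fun _ _ y _ => (hC y).trans (Real.le_coe_toNNReal C)
        mul_max_le := by
          have hCa : 0 ≤ C * a := mul_nonneg hC0 ha.le
          simp [hC0, hCa] }
    obtain ⟨γ, hγ0, hγ⟩ := hPL.exists_eq_forall_mem_Icc_hasDerivWithinAt₀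
    refine ⟨γ, hγ0, fun t ht => ?_⟩
    have h1 := (hγ t (Ioo_subset_Icc_self ht)).mono Ioo_subset_Icc_self
    exact hasMFDerivWithinAt_iff_hasFDerivWithinAt.2 h1

theorem flow_spec (hF : ContDiff ℝ ∞ F) {C : ℝ} (hC : ∀ x, ‖F x‖ ≤ C)
    (x : EuclideanSpace ℝ (Fin d)) :
    flow F 0 x = x ∧ ∀ s, HasDerivAt (fun t => flow F t x) (F (flow F s x)) s := by
  have h := exists_solution hF hC x
  have e : (fun t => flow F t x) = h.choose := by
    funext t; simp only [flow, dif_pos h]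
  have e' : ∀ t, flow F t x = h.choose t := fun t => congrFun e t
  refine ⟨by rw [e']; exact h.choose_spec.1, fun s => ?_⟩
  rw [e, e']
  exact h.choose_spec.2 s

/-- On a compact positively invariant set, the flow is jointly continuous in time and space. -/
theorem continuous_flow_restrict (hF : ContDiff ℝ ∞ F) {C : ℝ} (hC : ∀ x, ‖F x‖ ≤ C)
    {M : Set (EuclideanSpace ℝ (Fin d))} (hM : IsCompact M)
    (hinv : ∀ t, 0 ≤ t → ∀ x ∈ M, flow F t x ∈ M) :
    Continuous (fun p : M × ℝ≥0 => flow F p.2 (p.1 : EuclideanSpace ℝ (Fin d))) := by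
  obtain ⟨R, hR⟩ := hM.isBounded.subset_closedBall 0
  obtain ⟨K, hK⟩ := exists_lipschitzOnWith_closedBall hF 0 R
  have hKM := hK.mono hR
  have hd := fun x => (flow_spec hF hC x).2
  have h0 := fun x => (flow_spec hF hC x).1
  have hc : ∀ x, Continuous fun t => flow F t x := fun x =>
    continuous_iff_continuousAt.2 fun s => (hd x s).continuousAt
  refine continuous_prod_of_continuous_lipschitzWith' _ C.toNNReal (fun x => ?_) (fun t => ?_)
  · have h1 : LipschitzWith C.toNNReal fun t : ℝ => flow F t (x : EuclideanSpace ℝ (Fin d)) := by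
      refine lipschitzWith_of_nnnorm_deriv_le (𝕜 := ℝ) (fun s => (hd x s).differentiableAt)
        fun s => ?_
      rw [(hd x s).deriv, ← NNReal.coe_le_coe]
      exact (hC _).trans (Real.le_coe_toNNReal C)
    have h2 := h1.comp (isometry_subtype_coe (s := {r : ℝ | 0 ≤ r})).lipschitz
    rw [mul_one] at h2
    exact h2
  · have h1 : LipschitzWith (Real.exp (K * t)).toNNReal
        fun x : M => flow F t (x : EuclideanSpace ℝ (Fin d)) := by
      refine LipschitzWith.of_dist_le_mul fun x y => ?_
      have := dist_le_of_trajectories_ODE_of_mem (v := fun _ => F) (s := fun _ => M) (K := K)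
        (f := fun s => flow F s x) (g := fun s => flow F s y) (a := 0) (b := t)
        (δ := dist x y) (fun _ _ => hKM) (hc _).continuousOn
        (fun s _ => (hd x s).hasDerivWithinAt) (fun s hs => hinv s hs.1 x x.2) (hc _).continuousOn
        (fun s _ => (hd y s).hasDerivWithinAt) (fun s hs => hinv s hs.1 y y.2)
        (by simp only [h0]; exact le_rfl) t ⟨t.2, le_rfl⟩
      rw [sub_zero, mul_comm] at this
      rwa [Real.coe_toNNReal _ (Real.exp_pos _).le]
    exact h1.continuous

end Flow

/-! ### The data of the process -/

/-- The standing data: smooth bounded vector fields `F i`, a compact set `M` that is positively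
invariant under their flows, continuous jump rates `rate x i j` on `M`, irreducible at each point,
and a constant `lam` that strictly dominates all total jump rates. -/
structure System (d : ℕ) (E : Type*) [Fintype E] [DecidableEq E] where
  F : E → EuclideanSpace ℝ (Fin d) → EuclideanSpace ℝ (Fin d)
  smooth : ∀ i, ContDiff ℝ ∞ (F i)
  bounded : ∃ C : ℝ, ∀ i x, ‖F i x‖ ≤ C
  M : Set (EuclideanSpace ℝ (Fin d))
  isCompact : IsCompact M
  invariant : ∀ i, ∀ t : ℝ, 0 ≤ t → ∀ x ∈ M, flow (F i) t x ∈ M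
  rate : M → E → E → ℝ
  continuous_rate : ∀ i j, Continuous fun x => rate x i j
  rate_nonneg : ∀ x i j, i ≠ j → 0 ≤ rate x i j
  rate_self : ∀ x i, rate x i i = 0
  irreducible : ∀ x i j, Relation.ReflTransGen (fun a b => 0 < rate x a b) i j
  lam : ℝ
  lam_pos : 0 < lam
  sum_rate_lt : ∀ x i, ∑ j ∈ Finset.univ.erase i, rate x i j < lam

namespace System

variable {d : ℕ} {E : Type*} [Fintype E] [DecidableEq E] (S : System d E)

/-- The state space `M × E`. -/
abbrev State : Type _ := S.M × E

/-- The flow of the state: `(x, i)` is moved to `(Φ^i_t(x), i)`. -/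
noncomputable def move (z : S.State) (t : ℝ≥0) : S.State :=
  (⟨flow (S.F z.2) t z.1, S.invariant z.2 t t.2 z.1 z.1.2⟩, z.2)

/-- The transition matrix `Q(x) = (Q(x, i, j))`. -/
noncomputable def Qmat (x : S.M) (i j : E) : ℝ :=
  if i = j then 1 - ∑ k ∈ Finset.univ.erase i, S.rate x i k / S.lam else S.rate x i j / S.lam

theorem Qmat_nonneg (x : S.M) (i j : E) : 0 ≤ S.Qmat x i j := by
  unfold Qmat
  split_ifs with h
  · rw [← Finset.sum_div, sub_nonneg, div_le_one S.lam_pos]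
    exact (S.sum_rate_lt x i).le
  · exact div_nonneg (S.rate_nonneg x i j h) S.lam_pos.le

theorem sum_Qmat (x : S.M) (i : E) : ∑ j, S.Qmat x i j = 1 := by
  rw [← Finset.add_sum_erase _ _ (Finset.mem_univ i)]
  have : ∑ j ∈ Finset.univ.erase i, S.Qmat x i j
      = ∑ k ∈ Finset.univ.erase i, S.rate x i k / S.lam :=
    Finset.sum_congr rfl fun j hj => if_neg (Finset.ne_of_mem_erase hj).symm
  rw [this, Qmat, if_pos rfl]
  ring

theorem continuous_Qmat (i j : E) : Continuous fun x => S.Qmat x i j := by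
  unfold Qmat
  split_ifs
  · exact continuous_const.sub (continuous_finsetSum _ fun k _ => (S.continuous_rate i k).div_const _)
  · exact (S.continuous_rate i j).div_const _

/-- The law of the interarrival times: exponential of parameter `lam`, on `[0, ∞)`. -/
noncomputable def expLaw : Measure ℝ≥0 := (expMeasure S.lam).map Real.toNNReal

instance : IsProbabilityMeasure S.expLaw :=
  have := isProbabilityMeasure_expMeasure S.lam_pos
  Measure.isProbabilityMeasure_map measurable_real_toNNReal.aemeasurable

variable [MeasurableSpace E] [DiscreteMeasurableSpace E]

theorem measurable_move : Measurable fun p : S.State × ℝ≥0 => S.move p.1 p.2 := by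
  obtain ⟨C, hC⟩ := S.bounded
  have h : Measurable fun p : (S.M × ℝ≥0) × E =>
      flow (S.F p.2) p.1.2 (p.1.1 : EuclideanSpace ℝ (Fin d)) :=
    measurable_from_prod_countable_left fun i =>
      (continuous_flow_restrict (S.smooth i) (hC i) S.isCompact (S.invariant i)).measurable
  have h' : Measurable fun p : S.State × ℝ≥0 => ((p.1.1, p.2), p.1.2) := by fun_prop
  exact ((h.comp h').subtype_mk).prodMk (measurable_snd.comp measurable_fst)

/-- The Markov kernel `Q`: the position is kept, the index is redrawn from the matrix `Q(x)`. -/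
noncomputable def Q : Kernel S.State S.State where
  toFun z := ∑ j, ENNReal.ofReal (S.Qmat z.1 z.2 j) • Measure.dirac (z.1, j)
  measurable' := by
    refine Measure.measurable_of_measurable_coe _ fun A hA => ?_
    simp only [Measure.coe_finsetSum, Finset.sum_apply, Measure.smul_apply, smul_eq_mul]
    refine Finset.measurable_fun_sum _ fun j _ => Measurable.mul ?_ ?_
    · exact measurable_from_prod_countable_left fun i =>
        ENNReal.measurable_ofReal.comp (S.continuous_Qmat i j).measurable
    · have : Measurable fun z : S.State => (z.1, j) := by fun_prop
      exact (Measure.measurable_coe hA).comp (Measure.measurable_dirac.comp this)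

theorem Q_apply (z : S.State) :
    S.Q z = ∑ j, ENNReal.ofReal (S.Qmat z.1 z.2 j) • Measure.dirac (z.1, j) := rfl

instance : IsMarkovKernel S.Q := by
  refine ⟨fun z => ⟨?_⟩⟩
  rw [Q_apply]
  simp only [Measure.coe_finsetSum, Finset.sum_apply, Measure.smul_apply, measure_univ,
    smul_eq_mul, mul_one]
  rw [← ENNReal.ofReal_sum_of_nonneg fun j _ => S.Qmat_nonneg _ _ _, sum_Qmat, ENNReal.ofReal_one]

/-- From `z`, draw an exponential time `U` and return the pair `(move z U, U)`. -/
noncomputable def moveExp : Kernel S.State (S.State × ℝ≥0) :=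
  (Kernel.id ×ₖ Kernel.const S.State S.expLaw).map fun p => (S.move p.1 p.2, p.2)

instance : IsMarkovKernel S.moveExp :=
  Kernel.IsMarkovKernel.map _ (S.measurable_move.prodMk measurable_snd)

/-- The kernel `K̃ = ∫ lam * exp (-lam * t) K_t dt`: follow the flow for an exponential time. -/
noncomputable def Ktilde : Kernel S.State S.State := S.moveExp.map Prod.fst

instance : IsMarkovKernel S.Ktilde := Kernel.IsMarkovKernel.map _ measurable_fst

/-! ### The embedded chain and the continuous time process -/

/-- One step of the construction: from `z`, draw an exponential time `U`, follow the flow for the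
time `U`, redraw the index according to `Q`; the outcome is the new state together with `U`. -/
noncomputable def step : Kernel S.State (S.State × ℝ≥0) :=
  (S.Q ∥ₖ Kernel.id) ∘ₖ S.moveExp

instance : IsMarkovKernel S.step := by unfold step; infer_instance

/-- The transition kernel of the embedded chain. -/
noncomputable def Ptilde : Kernel S.State S.State := S.step.map Prod.fst

instance : IsMarkovKernel S.Ptilde := Kernel.IsMarkovKernel.map _ measurable_fst

/-- A path `n ↦ (Z̃_n, U_n)`: states of the embedded chain and interarrival times, `U_0` unused. -/
abbrev Path : Type _ := ℕ → S.State × ℝ≥0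

/-- The step kernel, seen as a function of the past of the path up to time `n`. -/
noncomputable def stepKernel (n : ℕ) :
    Kernel ((i : Finset.Iic n) → (fun _ : ℕ => S.State × ℝ≥0) i) (S.State × ℝ≥0) :=
  S.step.comap (fun h => (h ⟨n, Finset.mem_Iic.2 le_rfl⟩).1) (by fun_prop)

instance (n : ℕ) : IsMarkovKernel (S.stepKernel n) := by unfold stepKernel; infer_instance

/-- The law of the path `(Z̃_n, U_n)_n`, as a kernel in the initial state `Z̃_0`. -/
noncomputable def pathLaw : Kernel S.State S.Path :=
  (Kernel.traj (X := fun _ : ℕ => S.State × ℝ≥0) S.stepKernel 0).comap (fun z _ => (z, 0))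
    (by fun_prop)

instance : IsMarkovKernel S.pathLaw := by unfold pathLaw; infer_instance

/-- The jump times `T_n = U_1 + ... + U_n`. -/
def jumpTime (n : ℕ) (w : S.Path) : ℝ≥0 := ∑ k ∈ Finset.range n, (w (k + 1)).2

/-- The counting process `N_t`: the index `n` with `T_n ≤ t < T_{n+1}`. -/
noncomputable def count (t : ℝ≥0) (w : S.Path) : ℕ := sInf {n | t < S.jumpTime (n + 1) w}

/-- The continuous time process: `Z_t = (Φ^i_{t - T_n}(x), i)` for `T_n ≤ t < T_{n+1}`,
where `(x, i) = Z̃_n`. -/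
noncomputable def Z (t : ℝ≥0) (w : S.Path) : S.State :=
  S.move (w (S.count t w)).1 (t - S.jumpTime (S.count t w) w)

theorem measurable_jumpTime (n : ℕ) : Measurable (S.jumpTime n) := by
  unfold jumpTime; fun_prop

theorem measurable_count (t : ℝ≥0) : Measurable (S.count t) := by
  have hm : ∀ n, MeasurableSet {w : S.Path | t < S.jumpTime (n + 1) w} := fun n =>
    measurableSet_lt measurable_const (S.measurable_jumpTime _)
  refine measurable_to_countable' fun k => ?_
  have : S.count t ⁻¹' {k} =
      ({w | t < S.jumpTime (k + 1) w} ∩ ⋂ j ∈ Finset.range k, {w | t < S.jumpTime (j + 1) w}ᶜ) ∪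
      ({_w : S.Path | k = 0} ∩ ⋂ j, {w | t < S.jumpTime (j + 1) w}ᶜ) := by
    ext w
    simp only [count, mem_preimage, mem_singleton_iff, mem_union, mem_inter_iff, mem_ofPred_eq,
      mem_iInter, Finset.mem_range, mem_compl_iff]
    constructor
    · rintro rfl
      by_cases hne : {n | t < S.jumpTime (n + 1) w}.Nonempty
      · exact Or.inl ⟨Nat.sInf_mem hne, fun j hj => Nat.notMem_of_lt_sInf hj⟩
      · rw [not_nonempty_iff_eq_empty] at hne
        refine Or.inr ⟨by rw [hne, Nat.sInf_empty], fun j hj => ?_⟩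
        exact (hne ▸ (show j ∈ {n | t < S.jumpTime (n + 1) w} from hj) : j ∈ (∅ : Set ℕ))
    · rintro (⟨h1, h2⟩ | ⟨h1, h2⟩)
      · refine le_antisymm (Nat.sInf_le h1) (not_lt.1 fun hlt => ?_)
        exact h2 _ hlt (Nat.sInf_mem (s := {n | t < S.jumpTime (n + 1) w}) ⟨k, h1⟩)
      · have : {n | t < S.jumpTime (n + 1) w} = ∅ := eq_empty_of_forall_notMem h2
        rw [this, Nat.sInf_empty, h1]
  rw [this]
  refine MeasurableSet.union ((hm k).inter ?_) ((MeasurableSet.const _).inter ?_)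
  · exact Finset.measurableSet_biInter _ fun j _ => (hm j).compl
  · exact MeasurableSet.iInter fun j => (hm j).compl

theorem measurable_Z (t : ℝ≥0) : Measurable (S.Z t) := by
  have h : Measurable fun p : S.Path × ℕ => S.move (p.1 p.2).1 (t - S.jumpTime p.2 p.1) :=
    measurable_from_prod_countable_left fun n => S.measurable_move.comp
      ((measurable_pi_apply n).fst.prodMk (measurable_const.sub (S.measurable_jumpTime n)))
  exact h.comp (measurable_id.prodMk (S.measurable_count t))

/-- The semigroup of the process: `P t z` is the law of `Z_t` when the process starts at `z`. -/
noncomputable def P (t : ℝ≥0) : Kernel S.State S.State := S.pathLaw.map (S.Z t)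

instance (t : ℝ≥0) : IsMarkovKernel (S.P t) := Kernel.IsMarkovKernel.map _ (S.measurable_Z t)

end System

/-! ### Invariant, extremal and ergodic probabilities of a family of Markov kernels -/

section Invariant

variable {Ω : Type*} [MeasurableSpace Ω] {ι : Type*}

/-- The probability measures that are invariant under every kernel of the family. -/
def invariantProbs (κ : ι → Kernel Ω Ω) : Set (ProbabilityMeasure Ω) :=
  {μ | ∀ t, (κ t).Invariant (μ : Measure Ω)}

/-- The extremal points of a set of probability measures, seen inside the space of measures. -/
def extremalProbs (A : Set (ProbabilityMeasure Ω)) : Set (ProbabilityMeasure Ω) :=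
  {μ | (μ : Measure Ω) ∈ Set.extremePoints ℝ≥0 ((fun ν : ProbabilityMeasure Ω => (ν : Measure Ω)) '' A)}

/-- The ergodic probabilities: invariant, and giving measure `0` or `1` to each measurable set `A`
that is almost surely invariant, i.e. `κ t 1_A = 1_A` almost everywhere for all `t`. -/
def ergodicProbs (κ : ι → Kernel Ω Ω) : Set (ProbabilityMeasure Ω) :=
  {μ | μ ∈ invariantProbs κ ∧ ∀ A : Set Ω, MeasurableSet A →
    (∀ t, (fun z => κ t z A) =ᵐ[(μ : Measure Ω)] A.indicator 1) →
    (μ : Measure Ω) A = 0 ∨ (μ : Measure Ω) A = 1}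

/-- The image `μ κ` of a probability measure under a Markov kernel. -/
noncomputable def act (κ : Kernel Ω Ω) [IsMarkovKernel κ] (μ : ProbabilityMeasure Ω) :
    ProbabilityMeasure Ω :=
  ⟨(μ : Measure Ω).bind κ, inferInstance⟩

end Invariant

namespace System

variable {d : ℕ} {E : Type*} [Fintype E] [DecidableEq E] [MeasurableSpace E]
  [DiscreteMeasurableSpace E] (S : System d E)

/-- The invariant probabilities of the embedded chain. -/
def invChain : Set (ProbabilityMeasure S.State) := invariantProbs fun _ : Unit => S.Ptilde

/-- The invariant probabilities of the continuous time process. -/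
def invSemigroup : Set (ProbabilityMeasure S.State) := invariantProbs S.P

end System

/-- A process is stable if it has a unique invariant probability. -/
def Stable {Ω : Type*} [MeasurableSpace Ω] (I : Set (ProbabilityMeasure Ω)) : Prop :=
  ∃! μ, μ ∈ I

end SwitchedPDMP

/-!
The kernel of the embedded chain factors as `P̃ = K̃Q` (flow, then redraw), so `μ` is invariant for
`P̃` iff `μK̃Q = μ`. For the semigroup, condition on the last jump before `t`: as an exponential
clock that rings exactly once before `t` rings at a uniform time, the time elapsed since that jump
can be exchanged with the last interarrival time, whence Duhamel's formula
`P_t = e^{-λt} K_t + ∫₀ᵗ λ e^{-λu} P_{t-u} Q K_u du`. If `ν` is invariant for the semigroup, then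
dropping the first term and letting `t → ∞` gives `νQK̃ ≤ ν`, and equality holds since both have
mass one. Conversely, if `νQK̃ = ν`, then `ν` satisfies the equation above with `νP_t` and every
`νP_{t-u}` replaced by `ν`; iterating it shows that `ν` exceeds `νP_t` by at most `(1 - e^{-λt})ⁿ`
for every `n`, and again both have mass one. Hence `K̃` and `Q` induce mutually inverse affine maps
between the two sets of invariant probabilities, continuous because both kernels are Feller.

An extremal invariant probability is ergodic because it is a mixture of its conditionings on an
invariant set and on the complement. Conversely, if `μ` is ergodic and `ν ≪ μ` is invariant, then
the parts `(μ - ν)⁺` and `(ν - μ)⁺` are invariant and mutually singular, and ergodicity makes `μ`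
absolutely continuous with respect to each of them that is nonzero; so one of them vanishes.
-/

namespace SwitchedPDMP

section Ergodic

variable {Ω Ω' : Type*} [MeasurableSpace Ω] [MeasurableSpace Ω'] {ι : Type*}

theorem bind_le_bind (κ : Kernel Ω Ω') {μ ν : Measure Ω} (h : μ ≤ ν) : μ.bind κ ≤ ν.bind κ := by
  refine Measure.le_iff.2 fun A hA => ?_
  rw [Measure.bind_apply hA κ.aemeasurable, Measure.bind_apply hA κ.aemeasurable]
  exact lintegral_mono' h le_rfl

theorem invariant_of_bind_le {κ : Kernel Ω Ω} [IsMarkovKernel κ] {μ : Measure Ω}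
    [IsFiniteMeasure μ] (h : μ.bind κ ≤ μ) : κ.Invariant μ :=
  Measure.eq_of_le_of_measure_univ_eq h Measure.comp_apply_univ

theorem invariant_of_le_bind {κ : Kernel Ω Ω} [IsMarkovKernel κ] {μ : Measure Ω}
    [IsFiniteMeasure μ] (h : μ ≤ μ.bind κ) : κ.Invariant μ :=
  (Measure.eq_of_le_of_measure_univ_eq h Measure.comp_apply_univ.symm).symm

theorem invariant_sub {κ : Kernel Ω Ω} [IsMarkovKernel κ] {μ ν : Measure Ω} [IsFiniteMeasure μ]
    [IsFiniteMeasure ν] (hμ : κ.Invariant μ) (hν : κ.Invariant ν) : κ.Invariant (μ - ν) := by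
  have h : μ ≤ (μ - ν).bind κ + ν := by
    calc μ = μ.bind κ := hμ.def.symm
      _ ≤ (μ - ν + ν).bind κ := bind_le_bind κ (Measure.sub_le_iff_le_add.1 le_rfl)
      _ = (μ - ν).bind κ + ν := by rw [Measure.comp_add, hν.def]
  exact invariant_of_le_bind (Measure.sub_le_of_le_add h)

/-- `A` is almost surely invariant for the kernel `κ` under `μ`: `κ 1_A = 1_A` almost everywhere.
The ergodic probabilities are those giving mass `0` or `1` to every such measurable set. -/
def IsAEInvariantSet (κ : Kernel Ω Ω) (μ : Measure Ω) (A : Set Ω) : Prop :=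
  (fun z => κ z A) =ᵐ[μ] A.indicator 1

theorem IsAEInvariantSet.compl {κ : Kernel Ω Ω} [IsMarkovKernel κ] {μ : Measure Ω} {A : Set Ω}
    (h : IsAEInvariantSet κ μ A) (hA : MeasurableSet A) : IsAEInvariantSet κ μ Aᶜ := by
  filter_upwards [h] with z hz
  rw [prob_compl_eq_one_sub hA, hz]
  by_cases hzA : z ∈ A <;> simp [hzA]

theorem IsAEInvariantSet.invariant_restrict {κ : Kernel Ω Ω} [IsMarkovKernel κ] {μ : Measure Ω}
    [IsFiniteMeasure μ] {A : Set Ω} (h : IsAEInvariantSet κ μ A) (hA : MeasurableSet A)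
    (hμ : κ.Invariant μ) : κ.Invariant (μ.restrict A) := by
  have hcompl : (μ.restrict A).bind κ Aᶜ = 0 := by
    rw [Measure.bind_apply hA.compl κ.aemeasurable,
      setLIntegral_eq_zero_iff hA (κ.measurable_coe hA.compl)]
    filter_upwards [h.compl hA] with z hz hzA
    simp [hz, hzA]
  refine invariant_of_bind_le (Measure.le_iff.2 fun B hB => ?_)
  calc (μ.restrict A).bind κ B
      ≤ (μ.restrict A).bind κ (B ∩ A) + (μ.restrict A).bind κ Aᶜ :=
        (measure_mono (fun z hz => (em (z ∈ A)).imp (⟨hz, ·⟩) id)).trans (measure_union_le _ _)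
    _ ≤ μ (B ∩ A) := by
        rw [hcompl, add_zero]
        exact (bind_le_bind κ Measure.restrict_le_self _).trans_eq (by rw [hμ.def])
    _ = μ.restrict A B := (Measure.restrict_apply hB).symm

theorem IsAEInvariantSet.invariant_cond {κ : Kernel Ω Ω} [IsMarkovKernel κ] {μ : Measure Ω}
    [IsFiniteMeasure μ] {A : Set Ω} (h : IsAEInvariantSet κ μ A) (hA : MeasurableSet A)
    (hμ : κ.Invariant μ) : κ.Invariant (μ[|A]) := by
  rw [Kernel.Invariant, ProbabilityTheory.cond, Measure.comp_smul,
    (h.invariant_restrict hA hμ).def]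

theorem isAEInvariantSet_of_absorbing {κ : Kernel Ω Ω} [IsMarkovKernel κ] {μ : Measure Ω}
    [IsFiniteMeasure μ] {A : Set Ω} (hA : MeasurableSet A) (hμ : κ.Invariant μ)
    (h : ∀ᵐ z ∂μ, z ∈ A → κ z Aᶜ = 0) : IsAEInvariantSet κ μ A := by
  have hle : A.indicator 1 ≤ᵐ[μ] fun z => κ z A := by
    filter_upwards [h] with z hz
    by_cases hzA : z ∈ A
    · simp [hzA, (prob_compl_eq_zero_iff hA).1 (hz hzA)]
    · simp [hzA]
  have hint : ∫⁻ z, A.indicator 1 z ∂μ = μ A := lintegral_indicator_one hA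
  refine (ae_eq_of_ae_le_of_lintegral_le hle (by simp [hint])
    (κ.measurable_coe hA).aemeasurable ?_).symm
  rw [hint, ← Measure.bind_apply hA κ.aemeasurable, hμ.def]

theorem isAEInvariantSet_support_of_invariant_withDensity {κ : Kernel Ω Ω} [IsMarkovKernel κ]
    {μ : Measure Ω} [IsFiniteMeasure μ] (hμ : κ.Invariant μ) {f : Ω → ℝ≥0∞} (hf : Measurable f)
    (h : κ.Invariant (μ.withDensity f)) : IsAEInvariantSet κ μ f.support := by
  have hA : MeasurableSet f.support := measurableSet_support hf
  have hnull : (μ.withDensity f).bind κ f.supportᶜ = 0 := by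
    rw [h.def, withDensity_apply _ hA.compl, setLIntegral_eq_zero_iff hA.compl hf]
    exact .of_forall fun z hz => Function.notMem_support.1 hz
  rw [Measure.bind_apply hA.compl κ.aemeasurable,
    lintegral_eq_zero_iff (κ.measurable_coe hA.compl)] at hnull
  exact isAEInvariantSet_of_absorbing hA hμ ((ae_withDensity_iff hf).1 hnull)

theorem absolutelyContinuous_of_mem_ergodicProbs {κ : ι → Kernel Ω Ω} [∀ t, IsMarkovKernel (κ t)]
    {μ : ProbabilityMeasure Ω} (hμ : μ ∈ ergodicProbs κ) {σ : Measure Ω} [SigmaFinite σ]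
    (hσ : ∀ t, (κ t).Invariant σ) (hac : σ ≪ μ) (hσ0 : σ ≠ 0) : (μ : Measure Ω) ≪ σ := by
  have hf : Measurable (σ.rnDeriv μ) := Measure.measurable_rnDeriv σ μ
  have hdens : (μ : Measure Ω).withDensity (σ.rnDeriv μ) = σ :=
    Measure.withDensity_rnDeriv_eq σ μ hac
  rcases hμ.2 _ (measurableSet_support hf) fun t =>
    isAEInvariantSet_support_of_invariant_withDensity (hμ.1 t) hf (hdens.symm ▸ hσ t) with h | h
  · exact absurd (hdens ▸ (withDensity_eq_zero_iff hf.aemeasurable).2 (ae_iff.2 h)) hσ0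
  · rw [← hdens]
    exact withDensity_absolutelyContinuous' hf.aemeasurable
      ((mem_ae_iff_prob_eq_one (measurableSet_support hf)).2 h)

theorem eq_of_mem_ergodicProbs_of_absolutelyContinuous {κ : ι → Kernel Ω Ω}
    [∀ t, IsMarkovKernel (κ t)] {μ ν : ProbabilityMeasure Ω} (hμ : μ ∈ ergodicProbs κ)
    (hν : ν ∈ invariantProbs κ) (hac : (ν : Measure Ω) ≪ μ) : ν = μ := by
  have hμν : (μ : Measure Ω) - ν = 0 ∨ (ν : Measure Ω) - μ = 0 := by
    by_contra! h
    have h₁ := absolutelyContinuous_of_mem_ergodicProbs hμ (fun t => invariant_sub (hμ.1 t) (hν t))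
      (Measure.absolutelyContinuous_of_le Measure.sub_le) h.1
    have h₂ := absolutelyContinuous_of_mem_ergodicProbs hμ (fun t => invariant_sub (hν t) (hμ.1 t))
      ((Measure.absolutelyContinuous_of_le Measure.sub_le).trans hac) h.2
    have hself : (μ : Measure Ω) ⟂ₘ μ :=
      (Measure.mutually_singular_measure_sub (μ := (μ : Measure Ω)) (ν := ν)).mono_ac h₁ h₂
    exact IsProbabilityMeasure.ne_zero _ (Measure.MutuallySingular.self_iff _ |>.1 hself)
  rcases hμν with h | h
  · have hle : (μ : Measure Ω) ≤ ν := by simpa using Measure.sub_le_iff_le_add.1 h.le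
    exact ProbabilityMeasure.toMeasure_injective
      (Measure.eq_of_le_of_isProbabilityMeasure hle).symm
  · have hle : (ν : Measure Ω) ≤ μ := by simpa using Measure.sub_le_iff_le_add.1 h.le
    exact ProbabilityMeasure.toMeasure_injective (Measure.eq_of_le_of_isProbabilityMeasure hle)

theorem mem_extremalProbs_iff {I : Set (ProbabilityMeasure Ω)} {μ : ProbabilityMeasure Ω} :
    μ ∈ extremalProbs I ↔ μ ∈ I ∧ ∀ ν₁ ∈ I, ∀ ν₂ ∈ I, ∀ a b : ℝ≥0, 0 < a → 0 < b → a + b = 1 →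
      a • (ν₁ : Measure Ω) + b • (ν₂ : Measure Ω) = μ → ν₁ = μ := by
  have hinj : Function.Injective fun ν : ProbabilityMeasure Ω => (ν : Measure Ω) :=
    Subtype.val_injective
  simp only [extremalProbs, mem_ofPred_eq, mem_extremePoints_iff_left, hinj.mem_set_image,
    forall_mem_image, openSegment, hinj.eq_iff]
  refine and_congr_right fun _ => forall₄_congr fun ν₁ _ ν₂ _ => ?_
  exact ⟨fun h a b ha hb hab he => h ⟨a, b, ha, hb, hab, he⟩,
    fun h ⟨a, b, ha, hb, hab, he⟩ => h a b ha hb hab he⟩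

theorem mem_ergodicProbs_of_mem_extremalProbs {κ : ι → Kernel Ω Ω} [∀ t, IsMarkovKernel (κ t)]
    {μ : ProbabilityMeasure Ω} (hμ : μ ∈ extremalProbs (invariantProbs κ)) :
    μ ∈ ergodicProbs κ := by
  obtain ⟨hinv, hext⟩ := mem_extremalProbs_iff.1 hμ
  refine ⟨hinv, fun A hA h => ?_⟩
  replace h : ∀ t, IsAEInvariantSet (κ t) μ A := h
  by_contra! hcon
  obtain ⟨hA0, hA1⟩ := hcon
  have hAc0 : (μ : Measure Ω) Aᶜ ≠ 0 := fun hc => hA1 ((prob_compl_eq_zero_iff hA).1 hc)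
  have hsum : μ A + μ Aᶜ = 1 := by
    simpa [← ENNReal.coe_inj] using prob_add_prob_compl (μ := (μ : Measure Ω)) hA
  have hdecomp : μ A • (μ : Measure Ω)[|A] + μ Aᶜ • (μ : Measure Ω)[|Aᶜ] = μ := by
    ext B _
    simpa [ENNReal.smul_def, mul_comm] using cond_add_cond_compl_eq (t := B) hA (μ : Measure Ω)
  have hcond := hext
    ⟨_, cond_isProbabilityMeasure hA0⟩ (fun t => (h t).invariant_cond hA (hinv t))
    ⟨_, cond_isProbabilityMeasure hAc0⟩ (fun t => ((h t).compl hA).invariant_cond hA.compl (hinv t))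
    (μ A) (μ Aᶜ) (by simpa [pos_iff_ne_zero] using hA0) (by simpa [pos_iff_ne_zero] using hAc0)
    hsum hdecomp
  have hcondA := congrArg (fun ν : ProbabilityMeasure Ω => (ν : Measure Ω) A) hcond
  exact hA1 (hcondA.symm.trans (cond_apply_self hA0 (measure_ne_top _ _)))

theorem extremalProbs_invariantProbs (κ : ι → Kernel Ω Ω) [∀ t, IsMarkovKernel (κ t)] :
    extremalProbs (invariantProbs κ) = ergodicProbs κ := by
  refine Subset.antisymm (fun μ => mem_ergodicProbs_of_mem_extremalProbs) fun μ hμ => ?_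
  refine mem_extremalProbs_iff.2 ⟨hμ.1, fun ν₁ h₁ ν₂ _ a b ha _ _ he => ?_⟩
  refine eq_of_mem_ergodicProbs_of_absolutelyContinuous hμ h₁ ?_
  have hle : a • (ν₁ : Measure Ω) ≤ μ := he ▸ Measure.le_add_right le_rfl
  exact (Measure.absolutelyContinuous_smul (ENNReal.coe_ne_zero.2 ha.ne')).trans
    (Measure.absolutelyContinuous_of_le hle)

end Ergodic

section Transfer

variable {Ω : Type*} [MeasurableSpace Ω] {κ η : Kernel Ω Ω} [IsMarkovKernel κ] [IsMarkovKernel η]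
  {I J : Set (ProbabilityMeasure Ω)}

theorem act_mem_extremalProbs (hκ : MapsTo (act κ) I J) (hη : MapsTo (act η) J I)
    (hinv : InvOn (act η) (act κ) I J) {μ : ProbabilityMeasure Ω} (hμ : μ ∈ extremalProbs I) :
    act κ μ ∈ extremalProbs J := by
  obtain ⟨hμI, hext⟩ := mem_extremalProbs_iff.1 hμ
  refine mem_extremalProbs_iff.2 ⟨hκ hμI, fun ν₁ h₁ ν₂ h₂ a b ha hb hab he => ?_⟩
  have he' : a • (act η ν₁ : Measure Ω) + b • (act η ν₂ : Measure Ω) = μ := by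
    calc a • (act η ν₁ : Measure Ω) + b • (act η ν₂ : Measure Ω)
        = (a • (ν₁ : Measure Ω) + b • (ν₂ : Measure Ω)).bind η := by
          simp only [act, ProbabilityMeasure.coe_mk, ENNReal.smul_def, Measure.comp_add,
            Measure.comp_smul]
      _ = act η (act κ μ) := by rw [he]; rfl
      _ = μ := by rw [hinv.1 hμI]
  rw [← hext _ (hη h₁) _ (hη h₂) a b ha hb hab he', hinv.2 h₁]

theorem image_act_extremalProbs (hκ : MapsTo (act κ) I J) (hη : MapsTo (act η) J I)
    (hinv : InvOn (act η) (act κ) I J) : act κ '' extremalProbs I = extremalProbs J := by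
  refine Subset.antisymm
    (image_subset_iff.2 fun μ => act_mem_extremalProbs hκ hη hinv) fun ν hν => ?_
  exact ⟨act η ν, act_mem_extremalProbs hη hκ hinv.symm hν, hinv.2 (mem_extremalProbs_iff.1 hν).1⟩

theorem stable_congr (h : I ≃ J) : Stable I ↔ Stable J := by
  simp only [Stable, ← unique_subtype_iff_existsUnique]
  exact (Equiv.uniqueCongr h).nonempty_congr

theorem continuous_act [TopologicalSpace Ω] [OpensMeasurableSpace Ω]
    (hκ : ∀ g : BoundedContinuousFunction Ω ℝ, Continuous fun z => ∫ x, g x ∂κ z) :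
    Continuous (act κ) := by
  refine continuous_iff_continuousAt.2 fun μ => ?_
  refine ProbabilityMeasure.tendsto_iff_forall_integral_tendsto.2 fun g => ?_
  have hbound (z : Ω) : ‖∫ x, g x ∂κ z‖ ≤ ‖g‖ := by
    simpa using norm_integral_le_of_norm_le_const (μ := κ z) (.of_forall g.norm_coe_le_norm)
  have hint (ν : ProbabilityMeasure Ω) :
      ∫ x, g x ∂(act κ ν : Measure Ω) = ∫ z, ∫ x, g x ∂κ z ∂(ν : Measure Ω) := by
    have hg := g.integrable (μ := (act κ ν : Measure Ω))
    simp only [act, ProbabilityMeasure.coe_mk, Measure.comp_eq_comp_const_apply] at hg ⊢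
    rw [Kernel.integral_comp hg, Kernel.const_apply]
  simp only [hint]
  exact ProbabilityMeasure.tendsto_iff_forall_integral_tendsto.1 Filter.tendsto_id
    (BoundedContinuousFunction.ofNormedAddCommGroup _ (hκ g) ‖g‖ hbound)

end Transfer

section Trajectory

variable {X : ℕ → Type*} [∀ n, MeasurableSpace (X n)]

theorem lintegral_traj_frestrictLe (κ : (n : ℕ) → Kernel ((i : Finset.Iic n) → X i) (X (n + 1)))
    [∀ n, IsMarkovKernel (κ n)] (n : ℕ) (x : (i : Finset.Iic n) → X i)
    {f : ((i : Finset.Iic n) → X i) → ℝ≥0∞} (hf : Measurable f) :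
    ∫⁻ w, f (Preorder.frestrictLe n w) ∂Kernel.traj κ n x = f x := by
  rw [← lintegral_map hf (Preorder.measurable_frestrictLe n), Kernel.traj_map_frestrictLe_apply,
    Kernel.partialTraj_self, Kernel.id_apply, lintegral_dirac' _ hf]

theorem lintegral_traj_succ (κ : (n : ℕ) → Kernel ((i : Finset.Iic n) → X i) (X (n + 1)))
    [∀ n, IsMarkovKernel (κ n)] (x₀ : (i : Finset.Iic 0) → X i) (n : ℕ)
    {f : ((i : Finset.Iic n) → X i) × X (n + 1) → ℝ≥0∞} (hf : Measurable f) :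
    ∫⁻ w, f (Preorder.frestrictLe n w, w (n + 1)) ∂Kernel.traj κ 0 x₀ =
      ∫⁻ w, ∫⁻ y, f (Preorder.frestrictLe n w, y) ∂κ n (Preorder.frestrictLe n w)
        ∂Kernel.traj κ 0 x₀ := by
  have hm : Measurable fun w : (n : ℕ) → X n => (Preorder.frestrictLe n w, w (n + 1)) :=
    (Preorder.measurable_frestrictLe n).prodMk (measurable_pi_apply _)
  rw [← lintegral_map hf hm, ← Kernel.partialTraj_compProd_eq_map_traj (Nat.zero_le n),
    Measure.lintegral_compProd hf, ← Kernel.traj_map_frestrictLe_apply,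
    lintegral_map hf.lintegral_kernel_prod_right' (Preorder.measurable_frestrictLe n)]

end Trajectory

section FlowSemigroup

variable {d : ℕ} {F : EuclideanSpace ℝ (Fin d) → EuclideanSpace ℝ (Fin d)}

theorem eq_of_hasDerivAt_of_eq (hF : ContDiff ℝ ∞ F) {γ γ' : ℝ → EuclideanSpace ℝ (Fin d)}
    (hγ : ∀ t, HasDerivAt γ (F (γ t)) t) (hγ' : ∀ t, HasDerivAt γ' (F (γ' t)) t) {t₀ : ℝ}
    (h : γ t₀ = γ' t₀) : γ = γ' := by
  have hF1 : ContDiff ℝ 1 F := hF.of_le (by simp)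
  exact isMIntegralCurve_Ioo_eq_of_contMDiff_boundaryless (t₀ := t₀) (v := F)
    (I := modelWithCornersSelf ℝ (EuclideanSpace ℝ (Fin d)))
    (contMDiff_vectorSpace_iff_contDiff.2 hF1)
    (fun t => hasMFDerivAt_iff_hasFDerivAt.2 (hγ t).hasFDerivAt)
    (fun t => hasMFDerivAt_iff_hasFDerivAt.2 (hγ' t).hasFDerivAt) h

theorem flow_flow (hF : ContDiff ℝ ∞ F) {C : ℝ} (hC : ∀ x, ‖F x‖ ≤ C) (s t : ℝ)
    (x : EuclideanSpace ℝ (Fin d)) : flow F t (flow F s x) = flow F (s + t) x := by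
  have hflow := flow_spec hF hC
  have hcurves : (fun t => flow F t (flow F s x)) = fun t => flow F (s + t) x :=
    eq_of_hasDerivAt_of_eq hF (t₀ := 0) (hflow _).2
      (fun t => ((hflow x).2 (s + t)).comp_const_add s t) (by rw [(hflow _).1, add_zero])
  exact congrFun hcurves t

end FlowSemigroup

namespace System

section Clock

variable {d : ℕ} {E : Type*} [Fintype E] [DecidableEq E] (S : System d E)

/-- The survival function of the interarrival times: `surv u` is the probability that the clock has
not rung by time `u`. -/
noncomputable def surv (u : ℝ≥0) : ℝ≥0∞ := ENNReal.ofReal (Real.exp (-(S.lam * u)))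

@[fun_prop]
theorem measurable_surv : Measurable S.surv := by unfold surv; fun_prop

theorem surv_zero : S.surv 0 = 1 := by simp [surv]

theorem surv_ne_zero (t : ℝ≥0) : S.surv t ≠ 0 := by simp [surv, Real.exp_pos]

theorem antitone_surv : Antitone S.surv := fun _ _ h =>
  ENNReal.ofReal_le_ofReal <| Real.exp_le_exp.2 <| neg_le_neg <|
    mul_le_mul_of_nonneg_left (NNReal.coe_le_coe.2 h) S.lam_pos.le

theorem surv_add (s t : ℝ≥0) : S.surv (s + t) = S.surv s * S.surv t := by
  rw [surv, surv, surv, ← ENNReal.ofReal_mul (Real.exp_pos _).le, ← Real.exp_add, NNReal.coe_add]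
  ring_nf

theorem lintegral_expLaw {f : ℝ≥0 → ℝ≥0∞} (hf : Measurable f) :
    ∫⁻ u, f u ∂S.expLaw =
      ∫⁻ x in Ioi (0 : ℝ), ENNReal.ofReal S.lam * S.surv x.toNNReal * f x.toNNReal := by
  have hpdf : Measurable (exponentialPDF S.lam) :=
    (measurable_exponentialPDFReal S.lam).ennreal_ofReal
  rw [expLaw, lintegral_map hf measurable_real_toNNReal]
  change ∫⁻ x, f x.toNNReal ∂volume.withDensity (exponentialPDF S.lam) = _
  rw [lintegral_withDensity_eq_lintegral_mul _ hpdf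
      (g := fun x : ℝ => f x.toNNReal) (hf.comp measurable_real_toNNReal),
    ← lintegral_indicator measurableSet_Ioi]
  have hne : ∀ᵐ x : ℝ, x ≠ 0 := by simp [ae_iff]
  refine lintegral_congr_ae (hne.mono fun x hx => ?_)
  rcases hx.lt_or_gt with hneg | hpos
  · simp [exponentialPDF_of_neg hneg, hneg.le]
  · simp [exponentialPDF_of_nonneg hpos.le, hpos, surv, hpos.le, ENNReal.ofReal_mul S.lam_pos.le]

theorem setLIntegral_Ioi_expLaw {f : ℝ≥0 → ℝ≥0∞} (hf : Measurable f) (t : ℝ≥0) :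
    ∫⁻ u in Ioi t, f u ∂S.expLaw = S.surv t * ∫⁻ u, f (t + u) ∂S.expLaw := by
  rw [← lintegral_indicator measurableSet_Ioi,
    S.lintegral_expLaw (hf.indicator measurableSet_Ioi), S.lintegral_expLaw (by fun_prop),
    ← lintegral_const_mul _ (by fun_prop), ← lintegral_indicator measurableSet_Ioi,
    ← lintegral_indicator measurableSet_Ioi, ← lintegral_add_left_eq_self _ (t : ℝ)]
  refine lintegral_congr fun x => ?_
  by_cases hx : 0 < x
  · have htx : ((t : ℝ) + x).toNNReal = t + x.toNNReal := by
      rw [Real.toNNReal_add (NNReal.coe_nonneg t) hx.le, Real.toNNReal_coe]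
    have hpos : 0 < (t : ℝ) + x := by positivity
    simp only [indicator_apply, mem_Ioi, hx, hpos, htx, if_true, surv_add, lt_add_iff_pos_right,
      Real.toNNReal_pos]
    ring
  · have hle : ((t : ℝ) + x).toNNReal ≤ t := by
      rw [Real.toNNReal_le_iff_le_coe]; linarith
    simp [indicator_apply, hx, hle.not_gt]

theorem expLaw_Ioi (t : ℝ≥0) : S.expLaw (Ioi t) = S.surv t := by
  simpa using S.setLIntegral_Ioi_expLaw (f := 1) measurable_const t

theorem expLaw_Iic_lt_one (t : ℝ≥0) : S.expLaw (Iic t) < 1 := by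
  refine prob_le_one.lt_of_ne fun h => S.surv_ne_zero t ?_
  rw [← expLaw_Ioi, ← compl_Iic, prob_compl_eq_zero_iff measurableSet_Iic, h]

theorem setLIntegral_Iic_surv_expLaw {h : ℝ≥0 → ℝ≥0∞} (hh : Measurable h) (t : ℝ≥0) :
    ∫⁻ u in Iic t, S.surv (t - u) * h u ∂S.expLaw =
      ENNReal.ofReal S.lam * S.surv t * ∫⁻ x in Icc (0 : ℝ) t, h x.toNNReal := by
  rw [← lintegral_indicator measurableSet_Iic,
    S.lintegral_expLaw (Measurable.indicator (by fun_prop) measurableSet_Iic),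
    ← setLIntegral_congr Ioc_ae_eq_Icc, ← lintegral_const_mul _ (by fun_prop),
    ← lintegral_indicator measurableSet_Ioi, ← lintegral_indicator measurableSet_Ioc]
  refine lintegral_congr fun x => ?_
  by_cases hx : x ∈ Ioc 0 (t : ℝ)
  · have hxt : x.toNNReal ≤ t := Real.toNNReal_le_iff_le_coe.2 hx.2
    have hsplit : S.surv t = S.surv x.toNNReal * S.surv (t - x.toNNReal) := by
      rw [← surv_add, add_tsub_cancel_of_le hxt]
    rw [indicator_of_mem hx, indicator_of_mem (show x ∈ Ioi 0 from hx.1),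
      indicator_of_mem (show x.toNNReal ∈ Iic t from hxt), hsplit]
    ring
  · rw [indicator_of_notMem hx]
    refine indicator_apply_eq_zero.2 fun hpos => ?_
    rw [indicator_of_notMem (show x.toNNReal ∉ Iic t from fun hxt =>
      hx ⟨hpos, Real.toNNReal_le_iff_le_coe.1 hxt⟩), mul_zero]

/-- Conditionally on a single ring before time `t`, the ringing time is uniform on `[0, t]`. -/
theorem setLIntegral_Iic_surv_expLaw_reflect {h : ℝ≥0 → ℝ≥0∞} (hh : Measurable h) (t : ℝ≥0) :
    ∫⁻ u in Iic t, S.surv (t - u) * h (t - u) ∂S.expLaw =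
      ∫⁻ u in Iic t, S.surv (t - u) * h u ∂S.expLaw := by
  rw [S.setLIntegral_Iic_surv_expLaw (h := fun u => h (t - u)) (by fun_prop),
    S.setLIntegral_Iic_surv_expLaw hh, ← lintegral_indicator measurableSet_Icc,
    ← lintegral_indicator measurableSet_Icc, ← lintegral_sub_left_eq_self _ (t : ℝ)]
  congr 1
  refine lintegral_congr fun x => ?_
  by_cases hx : x ∈ Icc 0 (t : ℝ)
  · have hx' : (t : ℝ) - x ∈ Icc 0 (t : ℝ) := ⟨sub_nonneg.2 hx.2, sub_le_self _ hx.1⟩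
    have hxt : x.toNNReal ≤ t := Real.toNNReal_le_iff_le_coe.2 hx.2
    have htx : ((t : ℝ) - x).toNNReal = t - x.toNNReal := NNReal.eq <| by
      rw [NNReal.coe_sub hxt, Real.coe_toNNReal _ hx'.1, Real.coe_toNNReal _ hx.1]
    rw [indicator_of_mem hx, indicator_of_mem hx', htx, tsub_tsub_cancel_of_le hxt]
  · have hx' : (t : ℝ) - x ∉ Icc 0 (t : ℝ) := fun h' =>
      hx ⟨by linarith [h'.2], by linarith [h'.1]⟩
    rw [indicator_of_notMem hx, indicator_of_notMem hx']

theorem lintegral_surv_expLaw_lt_one : ∫⁻ u, S.surv u ∂S.expLaw < 1 := by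
  have hpos : ∀ᵐ u ∂S.expLaw, u ∈ Ioi (0 : ℝ≥0) :=
    (mem_ae_iff_prob_eq_one measurableSet_Ioi).2 (by rw [expLaw_Ioi, surv_zero])
  have hlt : ∀ᵐ u ∂S.expLaw, S.surv u < 1 := hpos.mono fun u hu => by
    simpa [surv] using mul_pos S.lam_pos (NNReal.coe_pos.2 hu)
  have hfin : ∫⁻ u, S.surv u ∂S.expLaw ≠ ⊤ :=
    ((lintegral_mono_ae (hlt.mono fun _ => le_of_lt)).trans_lt (by simp)).ne
  simpa using lintegral_strict_mono (IsProbabilityMeasure.ne_zero _) aemeasurable_const hfin hlt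

end Clock

section Counting

variable {d : ℕ} {E : Type*} [Fintype E] [DecidableEq E] (S : System d E)

theorem jumpTime_succ (n : ℕ) (w : S.Path) :
    S.jumpTime (n + 1) w = S.jumpTime n w + (w (n + 1)).2 := Finset.sum_range_succ _ _

theorem monotone_jumpTime (w : S.Path) : Monotone fun n => S.jumpTime n w :=
  monotone_nat_of_le_succ fun n => by rw [jumpTime_succ]; exact le_self_add

theorem count_eq {t : ℝ≥0} {w : S.Path} {n : ℕ} (hn : S.jumpTime n w ≤ t)
    (hn' : t < S.jumpTime (n + 1) w) : S.count t w = n :=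
  le_antisymm (Nat.sInf_le hn') <| le_csInf ⟨n, hn'⟩ fun _ hk =>
    le_of_not_gt fun hlt => ((S.monotone_jumpTime w hlt).trans hn).not_gt hk

theorem jumpTime_count_le (t : ℝ≥0) (w : S.Path) : S.jumpTime (S.count t w) w ≤ t := by
  rcases hc : S.count t w with _ | k
  · simp [jumpTime]
  · exact not_lt.1 (Nat.notMem_of_lt_sInf (show k < S.count t w by omega))

theorem lt_jumpTime_count_succ {t : ℝ≥0} {w : S.Path} (h : ∃ n, t < S.jumpTime (n + 1) w) :
    t < S.jumpTime (S.count t w + 1) w :=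
  Nat.sInf_mem h

end Counting

section Path

variable {d : ℕ} {E : Type*} [Fintype E] [DecidableEq E] [MeasurableSpace E]
  [DiscreteMeasurableSpace E] (S : System d E)

@[fun_prop]
theorem measurable_move_comp {α : Type*} [MeasurableSpace α] {f : α → S.State} {t : α → ℝ≥0}
    (hf : Measurable f) (ht : Measurable t) : Measurable fun a => S.move (f a) (t a) :=
  S.measurable_move.comp (hf.prodMk ht)

theorem lintegral_moveExp {f : S.State × ℝ≥0 → ℝ≥0∞} (hf : Measurable f) (z : S.State) :
    ∫⁻ y, f y ∂S.moveExp z = ∫⁻ u, f (S.move z u, u) ∂S.expLaw := by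
  have hm : Measurable fun p : S.State × ℝ≥0 => f (S.move p.1 p.2, p.2) := by fun_prop
  rw [moveExp, Kernel.lintegral_map _ (by fun_prop) _ hf, Kernel.prod_apply, Kernel.id_apply,
    Kernel.const_apply, lintegral_prod _ hm.aemeasurable, lintegral_dirac' _ (by fun_prop)]

theorem lintegral_step {f : S.State × ℝ≥0 → ℝ≥0∞} (hf : Measurable f) (z : S.State) :
    ∫⁻ y, f y ∂S.step z = ∫⁻ u, ∫⁻ z', f (z', u) ∂S.Q (S.move z u) ∂S.expLaw := by
  rw [step, Kernel.lintegral_comp _ _ _ hf, lintegral_moveExp _ hf.lintegral_kernel]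
  refine lintegral_congr fun u => ?_
  rw [Kernel.parallelComp_apply, lintegral_prod _ hf.aemeasurable]
  refine lintegral_congr fun z' => ?_
  rw [Kernel.id_apply, lintegral_dirac' _ (by fun_prop)]

theorem lintegral_Ktilde {g : S.State → ℝ≥0∞} (hg : Measurable g) (z : S.State) :
    ∫⁻ y, g y ∂S.Ktilde z = ∫⁻ u, g (S.move z u) ∂S.expLaw := by
  rw [Ktilde, Kernel.lintegral_map _ measurable_fst _ hg, lintegral_moveExp _ (by fun_prop)]

theorem Ptilde_eq_comp : S.Ptilde = S.Q ∘ₖ S.Ktilde := by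
  refine Kernel.ext_fun fun z g hg => ?_
  rw [Ptilde, Kernel.lintegral_map _ measurable_fst _ hg, lintegral_step _ (by fun_prop),
    Kernel.lintegral_comp _ _ _ hg, lintegral_Ktilde _ hg.lintegral_kernel]

theorem lintegral_pathLaw_zero (z : S.State) {f : S.State → ℝ≥0∞} (hf : Measurable f) :
    ∫⁻ w, f (w 0).1 ∂S.pathLaw z = f z :=
  lintegral_traj_frestrictLe (X := fun _ => S.State × ℝ≥0) S.stepKernel 0 (fun _ => (z, 0))
    (f := fun v => f (v ⟨0, Finset.mem_Iic.2 le_rfl⟩).1) (by fun_prop)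

theorem lintegral_pathLaw_succ (z : S.State) (n : ℕ)
    {f : (S.State × ℝ≥0) × (S.State × ℝ≥0) → ℝ≥0∞} (hf : Measurable f) :
    ∫⁻ w, f (((w n).1, S.jumpTime n w), w (n + 1)) ∂S.pathLaw z =
      ∫⁻ w, ∫⁻ y, f (((w n).1, S.jumpTime n w), y) ∂S.step (w n).1 ∂S.pathLaw z := by
  let time (v : (i : Finset.Iic n) → (fun _ : ℕ => S.State × ℝ≥0) i) : ℝ≥0 :=
    ∑ k : Finset.range n, (v ⟨k + 1, Finset.mem_Iic.2 (Finset.mem_range.1 k.2)⟩).2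
  have htime (w : S.Path) : time (Preorder.frestrictLe n w) = S.jumpTime n w :=
    Finset.sum_coe_sort (Finset.range n) fun k => (w (k + 1)).2
  have htime_meas : Measurable time := by fun_prop
  have h := lintegral_traj_succ (X := fun _ => S.State × ℝ≥0) S.stepKernel (fun _ => (z, 0)) n
    (f := fun p => f (((p.1 ⟨n, Finset.mem_Iic.2 le_rfl⟩).1, time p.1), p.2)) (by fun_prop)
  simp only [htime] at h
  exact h

/-- The law of the path `(Z̃_n, U_n)_n` when `Z̃_0` has law `ν`. -/
noncomputable def pathMeasure (ν : Measure S.State) : Measure S.Path := ν.bind S.pathLaw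

instance (ν : Measure S.State) [IsProbabilityMeasure ν] :
    IsProbabilityMeasure (S.pathMeasure ν) := by unfold pathMeasure; infer_instance

theorem lintegral_pathMeasure_succ (ν : Measure S.State) (n : ℕ)
    {f : (S.State × ℝ≥0) × (S.State × ℝ≥0) → ℝ≥0∞} (hf : Measurable f) :
    ∫⁻ w, f (((w n).1, S.jumpTime n w), w (n + 1)) ∂S.pathMeasure ν =
      ∫⁻ w, ∫⁻ y, f (((w n).1, S.jumpTime n w), y) ∂S.step (w n).1 ∂S.pathMeasure ν := by
  have hT := S.measurable_jumpTime n
  have hstep : Measurable fun p : S.State × ℝ≥0 => ∫⁻ y, f (p, y) ∂S.step p.1 :=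
    Measurable.lintegral_kernel_prod_right' (κ := S.step.comap Prod.fst measurable_fst) hf
  have hstep' : Measurable fun w : S.Path =>
      ∫⁻ y, f (((w n).1, S.jumpTime n w), y) ∂S.step (w n).1 :=
    hstep.comp (by fun_prop : Measurable fun w : S.Path => ((w n).1, S.jumpTime n w))
  rw [pathMeasure, Measure.lintegral_bind S.pathLaw.aemeasurable (by fun_prop),
    Measure.lintegral_bind S.pathLaw.aemeasurable hstep'.aemeasurable]
  exact lintegral_congr fun z => S.lintegral_pathLaw_succ z n hf

theorem lintegral_bind_P (ν : Measure S.State) (t : ℝ≥0) {g : S.State → ℝ≥0∞}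
    (hg : Measurable g) : ∫⁻ z, g z ∂(ν.bind (S.P t)) = ∫⁻ w, g (S.Z t w) ∂S.pathMeasure ν := by
  have hZ := S.measurable_Z t
  rw [pathMeasure, Measure.lintegral_bind (S.P t).aemeasurable hg.aemeasurable,
    Measure.lintegral_bind S.pathLaw.aemeasurable (by fun_prop)]
  exact lintegral_congr fun z => Kernel.lintegral_map _ hZ _ hg

/-- The joint law of `(Z̃_n, T_n)` when `Z̃_0` has law `ν`. -/
noncomputable def jumpLaw (ν : Measure S.State) (n : ℕ) : Measure (S.State × ℝ≥0) :=
  (S.pathMeasure ν).map fun w => ((w n).1, S.jumpTime n w)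

theorem measurable_prodMk_jumpTime (n : ℕ) :
    Measurable fun w : S.Path => ((w n).1, S.jumpTime n w) := by
  have hT := S.measurable_jumpTime n
  fun_prop

instance (ν : Measure S.State) [IsProbabilityMeasure ν] (n : ℕ) :
    IsProbabilityMeasure (S.jumpLaw ν n) :=
  Measure.isProbabilityMeasure_map (S.measurable_prodMk_jumpTime n).aemeasurable

theorem lintegral_jumpLaw (ν : Measure S.State) (n : ℕ) {f : S.State × ℝ≥0 → ℝ≥0∞}
    (hf : Measurable f) :
    ∫⁻ p, f p ∂S.jumpLaw ν n = ∫⁻ w, f ((w n).1, S.jumpTime n w) ∂S.pathMeasure ν :=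
  lintegral_map hf (S.measurable_prodMk_jumpTime n)

theorem lintegral_jumpLaw_zero (ν : Measure S.State) {f : S.State × ℝ≥0 → ℝ≥0∞}
    (hf : Measurable f) : ∫⁻ p, f p ∂S.jumpLaw ν 0 = ∫⁻ z, f (z, 0) ∂ν := by
  rw [S.lintegral_jumpLaw ν 0 hf, pathMeasure]
  simp only [jumpTime, Finset.range_zero, Finset.sum_empty]
  rw [Measure.lintegral_bind S.pathLaw.aemeasurable (Measurable.aemeasurable (by fun_prop))]
  exact lintegral_congr fun z => S.lintegral_pathLaw_zero z (f := fun z => f (z, 0)) (by fun_prop)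

theorem lintegral_jumpLaw_succ (ν : Measure S.State) (n : ℕ) {f : S.State × ℝ≥0 → ℝ≥0∞}
    (hf : Measurable f) :
    ∫⁻ p, f p ∂S.jumpLaw ν (n + 1) =
      ∫⁻ p, ∫⁻ y, f (y.1, p.2 + y.2) ∂S.step p.1 ∂S.jumpLaw ν n := by
  have hstep : Measurable fun p : S.State × ℝ≥0 => ∫⁻ y, f (y.1, p.2 + y.2) ∂S.step p.1 :=
    Measurable.lintegral_kernel_prod_right' (κ := S.step.comap Prod.fst measurable_fst)
      (f := fun q => f (q.2.1, q.1.2 + q.2.2)) (by fun_prop)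
  rw [S.lintegral_jumpLaw ν (n + 1) hf, S.lintegral_jumpLaw ν n hstep]
  simp only [jumpTime_succ]
  exact S.lintegral_pathMeasure_succ ν n (f := fun q => f (q.2.1, q.1.2 + q.2.2)) (by fun_prop)

theorem lintegral_surv_jumpLaw (ν : Measure S.State) [IsProbabilityMeasure ν] (n : ℕ) :
    ∫⁻ p, S.surv p.2 ∂S.jumpLaw ν n = (∫⁻ u, S.surv u ∂S.expLaw) ^ n := by
  induction n with
  | zero => simp [S.lintegral_jumpLaw_zero ν (f := fun p => S.surv p.2) (by fun_prop), surv_zero]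
  | succ n ih =>
    rw [S.lintegral_jumpLaw_succ ν n (f := fun p => S.surv p.2) (by fun_prop), pow_succ, ← ih,
      ← lintegral_mul_const _ (by fun_prop)]
    refine lintegral_congr fun p => ?_
    simp only [surv_add]
    rw [lintegral_const_mul _ (by fun_prop), S.lintegral_step (by fun_prop)]
    simp

theorem surv_mul_jumpLaw_le_pow (ν : Measure S.State) [IsProbabilityMeasure ν] (t : ℝ≥0) (n : ℕ) :
    S.surv t * S.jumpLaw ν n {p | p.2 ≤ t} ≤ (∫⁻ u, S.surv u ∂S.expLaw) ^ n := by
  rw [← S.lintegral_surv_jumpLaw ν]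
  refine le_trans ?_ (mul_meas_ge_le_lintegral (by fun_prop) (S.surv t))
  gcongr with p
  exact fun hp => S.antitone_surv hp

theorem ae_exists_lt_jumpTime (ν : Measure S.State) [IsProbabilityMeasure ν] (t : ℝ≥0) :
    ∀ᵐ w ∂S.pathMeasure ν, ∃ n, t < S.jumpTime (n + 1) w := by
  set B := {w : S.Path | ¬ ∃ n, t < S.jumpTime (n + 1) w}
  have hB (n : ℕ) : S.surv t * S.pathMeasure ν B ≤ (∫⁻ u, S.surv u ∂S.expLaw) ^ (n + 1) := by
    refine le_trans ?_ (S.surv_mul_jumpLaw_le_pow ν t (n + 1))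
    rw [jumpLaw, Measure.map_apply (S.measurable_prodMk_jumpTime _)
      (measurableSet_le measurable_snd measurable_const)]
    gcongr
    exact fun w hw => not_lt.1 fun hlt => hw ⟨n, hlt⟩
  have hlim := (ENNReal.tendsto_pow_atTop_nhds_zero_of_lt_one
    S.lintegral_surv_expLaw_lt_one).comp (Filter.tendsto_add_atTop_nat 1)
  exact (mul_eq_zero.1 (nonpos_iff_eq_zero.1 (ge_of_tendsto' hlim hB))).resolve_left
    (S.surv_ne_zero t)

end Path

section LastJump

variable {d : ℕ} {E : Type*} [Fintype E] [DecidableEq E] (S : System d E)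

/-- The conditional expectation of `g (Z_t)` on the event that no jump occurs in `(s, t]`, given
that the process jumps to the state `z` at time `s`; it is a function of `(z, s)`, which is `0` when
`s > t`. -/
noncomputable def lastJumpValue (t : ℝ≥0) (g : S.State → ℝ≥0∞) (p : S.State × ℝ≥0) : ℝ≥0∞ :=
  (Iic t).indicator (fun s => S.surv (t - s) * g (S.move p.1 (t - s))) p.2

theorem lastJumpValue_of_le {t s : ℝ≥0} (h : s ≤ t) (g : S.State → ℝ≥0∞) (z : S.State) :
    S.lastJumpValue t g (z, s) = S.surv (t - s) * g (S.move z (t - s)) :=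
  indicator_of_mem (s := Iic t) h _

theorem lastJumpValue_of_lt {t s : ℝ≥0} (h : t < s) (g : S.State → ℝ≥0∞) (z : S.State) :
    S.lastJumpValue t g (z, s) = 0 :=
  indicator_of_notMem (s := Iic t) h.not_ge _

variable [MeasurableSpace E] [DiscreteMeasurableSpace E]

theorem measurable_lastJumpValue_param {α : Type*} [MeasurableSpace α] {t s : α → ℝ≥0}
    {g : α → S.State → ℝ≥0∞} {z : α → S.State} (ht : Measurable t) (hs : Measurable s)
    (hg : Measurable fun q : α × S.State => g q.1 q.2) (hz : Measurable z) :
    Measurable fun a => S.lastJumpValue (t a) (g a) (z a, s a) := by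
  have hval : Measurable fun a => S.surv (t a - s a) * g a (S.move (z a) (t a - s a)) :=
    (S.measurable_surv.comp (ht.sub hs)).mul <| hg.comp <|
      measurable_id.prodMk (S.measurable_move_comp hz (ht.sub hs))
  exact Measurable.ite (measurableSet_le hs ht) hval measurable_const

theorem measurable_lastJumpValue (t : ℝ≥0) {g : S.State → ℝ≥0∞} (hg : Measurable g) :
    Measurable (S.lastJumpValue t g) :=
  S.measurable_lastJumpValue_param (g := fun _ => g) measurable_const measurable_snd (by fun_prop)
    measurable_fst

theorem measurableSet_jumpTime_le_and_lt (n : ℕ) (t : ℝ≥0) :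
    MeasurableSet {w : S.Path | S.jumpTime n w ≤ t ∧ t < S.jumpTime (n + 1) w} := by
  have hlt : MeasurableSet {w : S.Path | t < S.jumpTime (n + 1) w} :=
    measurableSet_lt measurable_const (S.measurable_jumpTime (n + 1))
  exact (measurableSet_le (S.measurable_jumpTime n) measurable_const).inter hlt

theorem lintegral_jumpTime_le_and_lt (ν : Measure S.State) (n : ℕ) (t : ℝ≥0) {g : S.State → ℝ≥0∞}
    (hg : Measurable g) :
    ∫⁻ w in {w | S.jumpTime n w ≤ t ∧ t < S.jumpTime (n + 1) w},
        g (S.move (w n).1 (t - S.jumpTime n w)) ∂S.pathMeasure ν =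
      ∫⁻ p, S.lastJumpValue t g p ∂S.jumpLaw ν n := by
  let f : (S.State × ℝ≥0) × (S.State × ℝ≥0) → ℝ≥0∞ :=
    {p | p.1.2 ≤ t ∧ t < p.1.2 + p.2.2}.indicator fun p => g (S.move p.1.1 (t - p.1.2))
  have hf : Measurable f := Measurable.indicator (by fun_prop) <|
    (measurableSet_le (by fun_prop) (by fun_prop)).inter
      (measurableSet_lt (by fun_prop) (by fun_prop))
  have hstep (z : S.State) (s : ℝ≥0) : ∫⁻ y, f ((z, s), y) ∂S.step z =
      S.lastJumpValue t g (z, s) := by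
    rw [S.lintegral_step (by fun_prop)]
    rcases le_or_gt s t with hst | hts
    · have hIoi (u : ℝ≥0) (z' : S.State) : f ((z, s), (z', u)) =
          (Ioi (t - s)).indicator (fun _ => g (S.move z (t - s))) u := by
        simp [f, indicator_apply, hst, tsub_lt_iff_left hst]
      simp only [hIoi, lintegral_const, measure_univ, mul_one]
      rw [lintegral_indicator_const measurableSet_Ioi, expLaw_Ioi, S.lastJumpValue_of_le hst,
        mul_comm]
    · simp [f, hts, S.lastJumpValue_of_lt hts]
  rw [S.lintegral_jumpLaw ν n (S.measurable_lastJumpValue t hg),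
    ← lintegral_indicator (S.measurableSet_jumpTime_le_and_lt n t)]
  simp only [← hstep]
  rw [← S.lintegral_pathMeasure_succ ν n hf]
  simp only [f, indicator_apply, mem_ofPred_eq, jumpTime_succ]

theorem lintegral_bind_P_eq_tsum (ν : Measure S.State) [IsProbabilityMeasure ν] (t : ℝ≥0)
    {g : S.State → ℝ≥0∞} (hg : Measurable g) :
    ∫⁻ z, g z ∂(ν.bind (S.P t)) = ∑' n, ∫⁻ p, S.lastJumpValue t g p ∂S.jumpLaw ν n := by
  let A (n : ℕ) : Set S.Path := {w | S.jumpTime n w ≤ t ∧ t < S.jumpTime (n + 1) w}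
  have hA (n : ℕ) : MeasurableSet (A n) := S.measurableSet_jumpTime_le_and_lt n t
  have hdisj : Pairwise (Function.onFun Disjoint A) := fun m n hmn =>
    Set.disjoint_left.2 fun w hm hn => hmn <|
      (S.count_eq hm.1 hm.2).symm.trans (S.count_eq hn.1 hn.2)
  have hcover : ⋃ n, A n =ᵐ[S.pathMeasure ν] univ := Filter.eventuallyEq_univ.2 <| by
    filter_upwards [S.ae_exists_lt_jumpTime ν t] with w hw
    exact mem_iUnion.2 ⟨S.count t w, S.jumpTime_count_le t w, S.lt_jumpTime_count_succ hw⟩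
  rw [S.lintegral_bind_P ν t hg, ← setLIntegral_univ,
    ← setLIntegral_congr hcover, lintegral_iUnion hA hdisj]
  refine tsum_congr fun n => ?_
  rw [← S.lintegral_jumpTime_le_and_lt ν n t hg]
  exact setLIntegral_congr_fun (hA n) fun w hw => by rw [Z, S.count_eq hw.1 hw.2]

/-- The expected value of `g` after a redraw of the index followed by the flow for a time `u`. -/
noncomputable def redrawMove (u : ℝ≥0) (g : S.State → ℝ≥0∞) (z : S.State) : ℝ≥0∞ :=
  ∫⁻ z', g (S.move z' u) ∂S.Q z

theorem measurable_redrawMove {α : Type*} [MeasurableSpace α] {g : S.State → ℝ≥0∞}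
    {u : α → ℝ≥0} {z : α → S.State} (hg : Measurable g) (hu : Measurable u) (hz : Measurable z) :
    Measurable fun a => S.redrawMove (u a) g (z a) :=
  Measurable.lintegral_kernel_prod_right' (κ := S.Q.comap z hz)
    (f := fun q => g (S.move q.2 (u q.1))) (by fun_prop)

theorem lintegral_lastJumpValue_step_add (s r : ℝ≥0) {g : S.State → ℝ≥0∞} (hg : Measurable g)
    (z : S.State) :
    ∫⁻ y, S.lastJumpValue (s + r) g (y.1, s + y.2) ∂S.step z =
      ∫⁻ u in Iic r, S.surv (r - u) * S.redrawMove (r - u) g (S.move z u) ∂S.expLaw := by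
  have hval := S.measurable_lastJumpValue (s + r) hg
  rw [S.lintegral_step (f := fun y => S.lastJumpValue (s + r) g (y.1, s + y.2)) (by fun_prop),
    ← lintegral_indicator measurableSet_Iic]
  refine lintegral_congr fun u => ?_
  by_cases hu : u ≤ r
  · rw [indicator_of_mem (show u ∈ Iic r from hu), redrawMove,
      ← lintegral_const_mul _ (by fun_prop)]
    refine lintegral_congr fun z' => ?_
    rw [S.lastJumpValue_of_le (by gcongr), add_tsub_add_eq_tsub_left]
  · rw [indicator_of_notMem (show u ∉ Iic r from hu)]
    simp [S.lastJumpValue_of_lt (add_lt_add_right (not_le.1 hu) s)]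

theorem setLIntegral_lastJumpValue_redrawMove (s r : ℝ≥0) (g : S.State → ℝ≥0∞) (z : S.State) :
    ∫⁻ u in Iic (s + r), S.lastJumpValue (s + r - u) (S.redrawMove u g) (z, s) ∂S.expLaw =
      ∫⁻ u in Iic r, S.surv (r - u) * S.redrawMove u g (S.move z (r - u)) ∂S.expLaw := by
  rw [← lintegral_indicator measurableSet_Iic, ← lintegral_indicator measurableSet_Iic]
  refine lintegral_congr fun u => ?_
  by_cases hu : u ≤ r
  · rw [indicator_of_mem (show u ∈ Iic r from hu),
      indicator_of_mem (show u ∈ Iic (s + r) from hu.trans le_add_self),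
      add_tsub_assoc_of_le hu, S.lastJumpValue_of_le le_self_add, add_tsub_cancel_left]
  · rw [indicator_of_notMem (show u ∉ Iic r from hu)]
    refine indicator_apply_eq_zero.2 fun hur => S.lastJumpValue_of_lt ?_ _ _
    exact (tsub_lt_iff_right hur).2 (add_lt_add_right (not_le.1 hu) s)

/-- On the left `u = y.2` is the last interarrival time before `t`; on the right, by reflection, it
is the time elapsed at `t` since the last jump. -/
theorem lintegral_lastJumpValue_step (t : ℝ≥0) {g : S.State → ℝ≥0∞} (hg : Measurable g)
    (p : S.State × ℝ≥0) :
    ∫⁻ y, S.lastJumpValue t g (y.1, p.2 + y.2) ∂S.step p.1 =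
      ∫⁻ u in Iic t, S.lastJumpValue (t - u) (S.redrawMove u g) p ∂S.expLaw := by
  obtain ⟨z, s⟩ := p
  rcases lt_or_ge t s with hts | hst
  · have hs (u : ℝ≥0) : t < s + u := hts.trans_le le_self_add
    have hs' (u : ℝ≥0) : t - u < s := tsub_le_self.trans_lt hts
    simp [S.lastJumpValue_of_lt (hs _), S.lastJumpValue_of_lt (hs' _)]
  · obtain ⟨r, rfl⟩ := exists_add_of_le hst
    have hmeas : Measurable fun u => S.redrawMove u g (S.move z (r - u)) :=
      S.measurable_redrawMove hg (by fun_prop) (by fun_prop)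
    rw [S.lintegral_lastJumpValue_step_add s r hg, S.setLIntegral_lastJumpValue_redrawMove s r g z,
      ← S.setLIntegral_Iic_surv_expLaw_reflect hmeas]
    refine setLIntegral_congr_fun measurableSet_Iic fun u hu => ?_
    rw [tsub_tsub_cancel_of_le hu]

theorem lintegral_lastJumpValue_jumpLaw_zero (ν : Measure S.State) (t : ℝ≥0) {g : S.State → ℝ≥0∞}
    (hg : Measurable g) :
    ∫⁻ p, S.lastJumpValue t g p ∂S.jumpLaw ν 0 = S.surv t * ∫⁻ z, g (S.move z t) ∂ν := by
  rw [S.lintegral_jumpLaw_zero ν (S.measurable_lastJumpValue t hg),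
    ← lintegral_const_mul _ (by fun_prop)]
  exact lintegral_congr fun z => by rw [S.lastJumpValue_of_le zero_le, tsub_zero]

theorem lintegral_lastJumpValue_jumpLaw_succ (ν : Measure S.State) [IsProbabilityMeasure ν] (n : ℕ)
    (t : ℝ≥0) {g : S.State → ℝ≥0∞} (hg : Measurable g) :
    ∫⁻ p, S.lastJumpValue t g p ∂S.jumpLaw ν (n + 1) =
      ∫⁻ u in Iic t, ∫⁻ p, S.lastJumpValue (t - u) (S.redrawMove u g) p ∂S.jumpLaw ν n
        ∂S.expLaw := by
  rw [S.lintegral_jumpLaw_succ ν n (S.measurable_lastJumpValue t hg)]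
  simp only [S.lintegral_lastJumpValue_step t hg]
  refine lintegral_lintegral_swap (Measurable.aemeasurable ?_)
  exact S.measurable_lastJumpValue_param (α := (S.State × ℝ≥0) × ℝ≥0)
    (g := fun q => S.redrawMove q.2 g) (by fun_prop) (by fun_prop)
    (S.measurable_redrawMove hg (by fun_prop) (by fun_prop)) (by fun_prop)

/-- Duhamel's formula: the first term is the event that there is no jump before `t`, and in the
second one `u` is the time elapsed at `t` since the last jump. -/
theorem lintegral_bind_P_eq_add (ν : Measure S.State) [IsProbabilityMeasure ν] (t : ℝ≥0)
    {g : S.State → ℝ≥0∞} (hg : Measurable g) :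
    ∫⁻ z, g z ∂(ν.bind (S.P t)) = S.surv t * ∫⁻ z, g (S.move z t) ∂ν +
      ∫⁻ u in Iic t, ∫⁻ z, S.redrawMove u g z ∂(ν.bind (S.P (t - u))) ∂S.expLaw := by
  have hmeas (n : ℕ) : Measurable fun u =>
      ∫⁻ p, S.lastJumpValue (t - u) (S.redrawMove u g) p ∂S.jumpLaw ν n :=
    Measurable.lintegral_prod_right' (f := fun q : ℝ≥0 × (S.State × ℝ≥0) =>
      S.lastJumpValue (t - q.1) (S.redrawMove q.1 g) q.2) <|
      S.measurable_lastJumpValue_param (α := ℝ≥0 × (S.State × ℝ≥0))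
        (g := fun q => S.redrawMove q.1 g) (by fun_prop) (by fun_prop)
        (S.measurable_redrawMove hg (by fun_prop) (by fun_prop)) (by fun_prop)
  rw [S.lintegral_bind_P_eq_tsum ν t hg, tsum_eq_zero_add' ENNReal.summable,
    S.lintegral_lastJumpValue_jumpLaw_zero ν t hg]
  simp only [S.lintegral_lastJumpValue_jumpLaw_succ ν _ t hg]
  rw [← lintegral_tsum fun n => (hmeas n).aemeasurable]
  congr 1
  refine lintegral_congr fun u => ?_
  rw [S.lintegral_bind_P_eq_tsum ν (t - u) (S.measurable_redrawMove hg (by fun_prop) (by fun_prop))]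

end LastJump

section Correspondence

variable {d : ℕ} {E : Type*} [Fintype E] [DecidableEq E] (S : System d E)

theorem move_move (z : S.State) (s t : ℝ≥0) : S.move (S.move z s) t = S.move z (s + t) := by
  obtain ⟨C, hC⟩ := S.bounded
  exact Prod.ext (Subtype.ext (flow_flow (S.smooth z.2) (hC z.2) s t z.1)) rfl

variable [MeasurableSpace E] [DiscreteMeasurableSpace E]

theorem lintegral_bind_Ktilde (ν : Measure S.State) [SFinite ν] {g : S.State → ℝ≥0∞}
    (hg : Measurable g) :
    ∫⁻ z, g z ∂(ν.bind S.Ktilde) = ∫⁻ u, ∫⁻ z, g (S.move z u) ∂ν ∂S.expLaw := by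
  rw [Measure.lintegral_bind S.Ktilde.aemeasurable hg.aemeasurable]
  simp only [S.lintegral_Ktilde hg]
  exact lintegral_lintegral_swap (Measurable.aemeasurable (by fun_prop))

theorem lintegral_bind_Q_move (ν : Measure S.State) (u : ℝ≥0) {g : S.State → ℝ≥0∞}
    (hg : Measurable g) :
    ∫⁻ z, g (S.move z u) ∂(ν.bind S.Q) = ∫⁻ z, S.redrawMove u g z ∂ν :=
  Measure.lintegral_bind S.Q.aemeasurable (Measurable.aemeasurable (by fun_prop))

theorem lintegral_bind_Q_bind_Ktilde (ν : Measure S.State) [SFinite ν] {g : S.State → ℝ≥0∞}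
    (hg : Measurable g) :
    ∫⁻ z, g z ∂((ν.bind S.Q).bind S.Ktilde) = ∫⁻ u, ∫⁻ z, S.redrawMove u g z ∂ν ∂S.expLaw := by
  rw [S.lintegral_bind_Ktilde _ hg]
  simp only [S.lintegral_bind_Q_move ν _ hg]

theorem bind_Q_bind_Ktilde_of_invariant_P {ν : Measure S.State} [IsProbabilityMeasure ν]
    (h : ∀ t, (S.P t).Invariant ν) : (ν.bind S.Q).bind S.Ktilde = ν := by
  have hle (t : ℝ≥0) {g : S.State → ℝ≥0∞} (hg : Measurable g) :
      ∫⁻ u in Iic t, ∫⁻ z, S.redrawMove u g z ∂ν ∂S.expLaw ≤ ∫⁻ z, g z ∂ν := by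
    have hduhamel := S.lintegral_bind_P_eq_add ν t hg
    simp only [(h _).def] at hduhamel
    exact hduhamel ▸ le_add_self
  have hcover : ⋃ n : ℕ, Iic (n : ℝ≥0) = univ :=
    eq_univ_of_forall fun x => mem_iUnion.2 (exists_nat_ge x)
  have hdir : Directed (· ⊆ ·) fun n : ℕ => Iic (n : ℝ≥0) :=
    Monotone.directed_le fun m n hmn => Iic_subset_Iic.2 (Nat.cast_le.2 hmn)
  rw [Measure.comp_assoc]
  refine invariant_of_bind_le (κ := S.Ktilde ∘ₖ S.Q) (Measure.le_iff.2 fun A hA => ?_)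
  have hg : Measurable (A.indicator (1 : S.State → ℝ≥0∞)) := measurable_one.indicator hA
  rw [← Measure.comp_assoc, ← lintegral_indicator_one hA, ← lintegral_indicator_one hA,
    S.lintegral_bind_Q_bind_Ktilde ν hg, ← setLIntegral_univ, ← hcover,
    setLIntegral_iUnion_of_directed _ hdir]
  exact iSup_le fun n => hle n hg

theorem lintegral_bind_Ktilde_eq_add (ν : Measure S.State) [SFinite ν] (t : ℝ≥0)
    {g : S.State → ℝ≥0∞} (hg : Measurable g) :
    ∫⁻ z, g z ∂(ν.bind S.Ktilde) = S.surv t * ∫⁻ z, g (S.move z t) ∂(ν.bind S.Ktilde) +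
      ∫⁻ u in Iic t, ∫⁻ z, g (S.move z u) ∂ν ∂S.expLaw := by
  have hmeas : Measurable fun u => ∫⁻ z, g (S.move z u) ∂ν :=
    Measurable.lintegral_prod_right' (f := fun q => g (S.move q.2 q.1)) (by fun_prop)
  rw [S.lintegral_bind_Ktilde ν hg, S.lintegral_bind_Ktilde ν (g := fun z => g (S.move z t))
    (by fun_prop), ← lintegral_add_compl _ (measurableSet_Iic (a := t)), compl_Iic,
    S.setLIntegral_Ioi_expLaw hmeas, add_comm]
  simp only [move_move, add_comm t]

theorem lintegral_le_lintegral_bind_P_add_pow {ν : Measure S.State} [IsProbabilityMeasure ν]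
    (h : (ν.bind S.Q).bind S.Ktilde = ν) (t : ℝ≥0) (n : ℕ) :
    ∀ s ≤ t, ∀ g : S.State → ℝ≥0∞, Measurable g → g ≤ 1 →
      ∫⁻ z, g z ∂ν ≤ ∫⁻ z, g z ∂(ν.bind (S.P s)) + S.expLaw (Iic t) ^ n := by
  induction n with
  | zero =>
    intro s _ g _ hg1
    calc ∫⁻ z, g z ∂ν ≤ ∫⁻ _, 1 ∂ν := lintegral_mono hg1
      _ ≤ ∫⁻ z, g z ∂(ν.bind (S.P s)) + S.expLaw (Iic t) ^ 0 := by simp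
  | succ n ih =>
    intro s hst g hg hg1
    have hredraw (u : ℝ≥0) : Measurable (S.redrawMove u g) :=
      S.measurable_redrawMove hg measurable_const measurable_id
    have hredraw_le (u : ℝ≥0) : S.redrawMove u g ≤ 1 := fun z =>
      (lintegral_mono fun z' => hg1 (S.move z' u)).trans_eq (by simp)
    have hfix : ∫⁻ z, g z ∂ν = S.surv s * ∫⁻ z, g (S.move z s) ∂ν +
        ∫⁻ u in Iic s, ∫⁻ z, S.redrawMove u g z ∂ν ∂S.expLaw := by
      simpa only [h, S.lintegral_bind_Q_move ν _ hg] using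
        S.lintegral_bind_Ktilde_eq_add (ν.bind S.Q) s hg
    calc ∫⁻ z, g z ∂ν
        ≤ S.surv s * ∫⁻ z, g (S.move z s) ∂ν + ∫⁻ u in Iic s,
            (∫⁻ z, S.redrawMove u g z ∂(ν.bind (S.P (s - u))) + S.expLaw (Iic t) ^ n)
              ∂S.expLaw := by
          rw [hfix]
          gcongr with u
          exact ih (s - u) (tsub_le_self.trans hst) _ (hredraw u) (hredraw_le u)
      _ = ∫⁻ z, g z ∂(ν.bind (S.P s)) + S.expLaw (Iic t) ^ n * S.expLaw (Iic s) := by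
          rw [lintegral_add_right _ measurable_const, setLIntegral_const, ← add_assoc,
            ← S.lintegral_bind_P_eq_add ν s hg]
      _ ≤ ∫⁻ z, g z ∂(ν.bind (S.P s)) + S.expLaw (Iic t) ^ (n + 1) := by
          rw [pow_succ]
          gcongr

theorem invariant_P_of_bind_Q_bind_Ktilde {ν : Measure S.State} [IsProbabilityMeasure ν]
    (h : (ν.bind S.Q).bind S.Ktilde = ν) (t : ℝ≥0) : (S.P t).Invariant ν := by
  refine invariant_of_le_bind (Measure.le_iff.2 fun A hA => ?_)
  have hg : Measurable (A.indicator (1 : S.State → ℝ≥0∞)) := measurable_one.indicator hA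
  have hlim := (ENNReal.tendsto_pow_atTop_nhds_zero_of_lt_one
    (S.expLaw_Iic_lt_one t)).const_add (ν.bind (S.P t) A)
  rw [add_zero] at hlim
  refine ge_of_tendsto' hlim fun n => ?_
  simpa only [lintegral_indicator_one hA] using S.lintegral_le_lintegral_bind_P_add_pow h t n t
    le_rfl _ hg (indicator_le_self' fun _ _ => zero_le_one)

theorem mem_invSemigroup_iff (ν : ProbabilityMeasure S.State) :
    ν ∈ S.invSemigroup ↔ act S.Ktilde (act S.Q ν) = ν :=
  ⟨fun h => Subtype.ext (S.bind_Q_bind_Ktilde_of_invariant_P h),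
    fun h => S.invariant_P_of_bind_Q_bind_Ktilde (congrArg Subtype.val h)⟩

theorem mem_invChain_iff (μ : ProbabilityMeasure S.State) :
    μ ∈ S.invChain ↔ act S.Q (act S.Ktilde μ) = μ := by
  have hcomp : (μ : Measure S.State).bind S.Ptilde =
      ((μ : Measure S.State).bind S.Ktilde).bind S.Q := by
    rw [Ptilde_eq_comp, Measure.comp_assoc]
  exact ⟨fun h => Subtype.ext (hcomp.symm.trans (h ())),
    fun h _ => hcomp.trans (congrArg Subtype.val h)⟩

theorem leftInvOn_act_Q : LeftInvOn (act S.Q) (act S.Ktilde) S.invChain := fun _ hμ =>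
  (S.mem_invChain_iff _).1 hμ

theorem leftInvOn_act_Ktilde : LeftInvOn (act S.Ktilde) (act S.Q) S.invSemigroup := fun _ hν =>
  (S.mem_invSemigroup_iff _).1 hν

theorem mapsTo_act_Ktilde : MapsTo (act S.Ktilde) S.invChain S.invSemigroup := fun _ hμ =>
  (S.mem_invSemigroup_iff _).2 (congrArg _ (S.leftInvOn_act_Q hμ))

theorem mapsTo_act_Q : MapsTo (act S.Q) S.invSemigroup S.invChain := fun _ hν =>
  (S.mem_invChain_iff _).2 (congrArg _ (S.leftInvOn_act_Ktilde hν))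

end Correspondence

section Feller

variable {d : ℕ} {E : Type*} [Fintype E] [DecidableEq E] [TopologicalSpace E] [DiscreteTopology E]
  (S : System d E)

theorem continuous_move (u : ℝ≥0) : Continuous fun z : S.State => S.move z u := by
  obtain ⟨C, hC⟩ := S.bounded
  refine continuous_prod_of_discrete_right.2 fun i => ?_
  have hflow := (continuous_flow_restrict (S.smooth i) (hC i) S.isCompact (S.invariant i)).comp
    (continuous_id.prodMk (continuous_const (y := u)))
  exact (hflow.subtype_mk _).prodMk continuous_const

variable [MeasurableSpace E] [DiscreteMeasurableSpace E]

theorem integral_Ktilde (g : BoundedContinuousFunction S.State ℝ) (z : S.State) :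
    ∫ y, g y ∂S.Ktilde z = ∫ u, g (S.move z u) ∂S.expLaw := by
  have hKtilde : S.Ktilde z = S.expLaw.map fun u => S.move z u := by
    refine Measure.ext_of_lintegral _ fun f hf => ?_
    rw [S.lintegral_Ktilde hf, lintegral_map hf (by fun_prop)]
  rw [hKtilde, integral_map (Measurable.aemeasurable (by fun_prop))
    g.continuous.measurable.aestronglyMeasurable]

theorem integral_Q (g : BoundedContinuousFunction S.State ℝ) (z : S.State) :
    ∫ y, g y ∂S.Q z = ∑ j, S.Qmat z.1 z.2 j * g (z.1, j) := by
  rw [Q_apply, integral_finsetSum_measure fun j _ =>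
    (g.integrable (Measure.dirac (z.1, j))).smul_measure ENNReal.ofReal_ne_top]
  refine Finset.sum_congr rfl fun j _ => ?_
  rw [integral_smul_measure, integral_dirac' _ _ g.continuous.measurable.stronglyMeasurable,
    ENNReal.toReal_ofReal (S.Qmat_nonneg _ _ _), smul_eq_mul]

theorem continuous_act_Ktilde : Continuous (act S.Ktilde) := by
  refine continuous_act fun g => ?_
  have hg : Measurable g := g.continuous.measurable
  simp only [S.integral_Ktilde g]
  exact continuous_of_dominated (bound := fun _ => ‖g‖)
    (fun z => Measurable.aestronglyMeasurable (by fun_prop))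
    (fun z => .of_forall fun u => g.norm_coe_le_norm _) (integrable_const _)
    (.of_forall fun u => g.continuous.comp (S.continuous_move u))

theorem continuous_act_Q : Continuous (act S.Q) := by
  refine continuous_act fun g => ?_
  simp only [S.integral_Q g]
  exact continuous_finsetSum _ fun j _ =>
    (continuous_prod_of_discrete_right.2 fun i => S.continuous_Qmat i j).mul (by fun_prop)

/-- The homeomorphism `μ ↦ μ K̃` between the invariant probabilities of the embedded chain and those
of the semigroup, with inverse `ν ↦ ν Q`. -/
noncomputable def invChainHomeomorph : S.invChain ≃ₜ S.invSemigroup where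
  toFun := S.mapsTo_act_Ktilde.restrict
  invFun := S.mapsTo_act_Q.restrict
  left_inv μ := Subtype.ext (S.leftInvOn_act_Q μ.2)
  right_inv ν := Subtype.ext (S.leftInvOn_act_Ktilde ν.2)
  continuous_toFun := S.continuous_act_Ktilde.continuousOn.mapsToRestrict S.mapsTo_act_Ktilde
  continuous_invFun := S.continuous_act_Q.continuousOn.mapsToRestrict S.mapsTo_act_Q

end Feller

end System

end SwitchedPDMP

theorem mainTheorem9 {d : ℕ} {E : Type*} [Fintype E] [DecidableEq E]
    [TopologicalSpace E] [DiscreteTopology E] [MeasurableSpace E] [DiscreteMeasurableSpace E]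
    (S : SwitchedPDMP.System d E) :
    (∃ h : S.invChain ≃ₜ S.invSemigroup,
      (∀ μ : S.invChain, (h μ : ProbabilityMeasure S.State) = SwitchedPDMP.act S.Ktilde μ) ∧
      (∀ ν : S.invSemigroup, (h.symm ν : ProbabilityMeasure S.State) = SwitchedPDMP.act S.Q ν)) ∧
    SwitchedPDMP.act S.Ktilde '' SwitchedPDMP.extremalProbs S.invChain =
      SwitchedPDMP.extremalProbs S.invSemigroup ∧
    SwitchedPDMP.extremalProbs S.invChain = SwitchedPDMP.ergodicProbs (fun _ : Unit => S.Ptilde) ∧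
    SwitchedPDMP.extremalProbs S.invSemigroup = SwitchedPDMP.ergodicProbs S.P ∧
    (SwitchedPDMP.Stable S.invSemigroup ↔ SwitchedPDMP.Stable S.invChain) := by
  have hK := S.mapsTo_act_Ktilde
  have hQ := S.mapsTo_act_Q
  have hinv : InvOn (SwitchedPDMP.act S.Q) (SwitchedPDMP.act S.Ktilde) S.invChain S.invSemigroup :=
    ⟨S.leftInvOn_act_Q, S.leftInvOn_act_Ktilde⟩
  exact ⟨⟨S.invChainHomeomorph, fun _ => rfl, fun _ => rfl⟩,
    SwitchedPDMP.image_act_extremalProbs hK hQ hinv,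
    SwitchedPDMP.extremalProbs_invariantProbs fun _ : Unit => S.Ptilde,
    SwitchedPDMP.extremalProbs_invariantProbs S.P,
    (SwitchedPDMP.stable_congr S.invChainHomeomorph.toEquiv).symm⟩
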